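/- Let $\Gamma$ be a commutative cancellative monoid (written additively) whose quotient group is torsion-free, let $R=\bigoplus_{\alpha\in\Gamma}R_\alpha$ be a $\Gamma$-graded integral domain with quotient field $K$, and assume that $R$ contains a unit that is homogeneous of nonzero degree. Let $H$ be the set of nonzero homogeneous elements of $R$, so that $R\subseteq R_H\subseteq K$, and for $f\in R$ let $C(f)$ be the ideal of $R$ generated by the homogeneous components of $f$. A semistar operation on $R$ is a map $E\mapsto E^\star$ from the set of nonzero $R$-submodules of $K$ to itself such that, for all such $E,F$ and all $0\ne x\in K$: $(xE)^\star=xE^\star$; $E\subseteq F$ implies $E^\star\subseteq F^\star$; $E\subseteq E^\star=(E^\star)^\star$. Write $f(R)$ for the set of nonzero finitely generated $R$-submodules of $K$. Associated to $\star$ are $$E^{\star_f}=\bigcup\{F^\star\mid F\in f(R),\,F\subseteq E\},\qquad E^{\widetilde\star}=\{x\in K\mid xJ\subseteq E\text{ for some }J\in f(R),\ J\subseteq R,\ J^\star=R^\star\},$$ $$F^{\star_a}=\bigcup\{((FG)^\star:G^\star)\mid G\in f(R)\}\ \ (F\in f(R)),\qquad E^{\star_a}=\bigcup\{F^{\star_a}\mid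 F\in f(R),\,F\subseteq E\},$$ where $(A:B)=\{x\in K\mid xB\subseteq A\}$; the map $\widetilde\star$ is again a semistar operation, and $\widetilde\star_a$ denotes $(\widetilde\star)_a$. Let $\star$ be a semistar operation on $R$ with $R^\star\subsetneq R_H$. Put $N_\star(H)=\{f\in R\mid f\neq0,\ C(f)^\star=R^\star\}$, which is a multiplicative subset of $R$, and $$\mathrm{Kr}(R,\widetilde\star)=\Big\{\tfrac fg\in K\ \Big|\ f,g\in R,\ g\neq0,\ C(f)C(h)\subseteq(C(g)C(h))^{\widetilde\star}\text{ for some }0\ne h\in R\Big\}.$$ Then $\mathrm{Kr}(R,\widetilde\star)$ is a subring of $K$ containing $R$, and the following statements are equivalent: 1. $R$ is a graded P$\star$MD, i.e. $(II^{-1})^{\star_f}=R^\star$ for every nonzero finitely generated homogeneous ideal $I$ of $R$, where $I^{-1}=(R:I)$. 2. Every ideal of $R_{N_\star(H)}$ is extended from a homogeneous ideal of $R$. 3. Every principal ideal of $R_{N_\star(H)}$ is extended from a homogeneous ideal of $R$. 4. $R_{N_\star(H)}$ is a Prüfer domain. 5. $R_{N_\star(H)}$ is a Bézout domain. 6. $R_{N_\star(H)}=\mathrm{Kr}(R,\widetilde\star)$.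 7. $\mathrm{Kr}(R,\widetilde\star)$ is a quotient ring of $R$, i.e. equal to $R_S$ for some multiplicative subset $S$ of $R$. 8. $\mathrm{Kr}(R,\widetilde\star)$ is a flat $R$-module. 9. $I^{\widetilde\star}=I^{\widetilde\star_a}$ for every nonzero finitely generated homogeneous ideal $I$ of $R$. Moreover, if $R$ is a graded P$\star$MD, then $R^{\widetilde\star}$ is integrally closed. -/

import Mathlib

open scoped Pointwise nonZeroDivisors

/-! ### Semistar operations -/

/-- A semistar operation on a domain `R` with quotient field `K`. It acts on the nonzero
`R`-submodules of `K`; it is extended to all submodules by `0 ↦ 0`, and with this convention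
(which every semistar operation satisfies in exactly one way) the axioms hold for all
submodules. -/
structure SemistarOperation (R K : Type*) [CommRing R] [Field K] [Algebra R K] where
  /-- the map `E ↦ E^⋆` -/
  toFun : Submodule R K → Submodule R K
  bot' : toFun ⊥ = ⊥
  smul' : ∀ (x : K), x ≠ 0 → ∀ E : Submodule R K, toFun (x • E) = x • toFun E
  mono' : ∀ E F : Submodule R K, E ≤ F → toFun E ≤ toFun F
  le' : ∀ E : Submodule R K, E ≤ toFun E
  idem' : ∀ E : Submodule R K, toFun (toFun E) = toFun E

namespace SemistarOperation

variable {R K : Type*} [CommRing R] [Field K] [Algebra R K]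

instance : CoeFun (SemistarOperation R K) (fun _ => Submodule R K → Submodule R K) :=
  ⟨SemistarOperation.toFun⟩

theorem mem_smul_iff {x : K} (hx : x ≠ 0) (E : Submodule R K) (y : K) :
    y ∈ x • E ↔ x⁻¹ * y ∈ E := by
  constructor
  · rintro ⟨z, hz, rfl⟩
    simpa [hx] using hz
  · intro h
    have := Submodule.smul_mem_pointwise_smul _ x E h
    simpa [hx] using this

theorem mul_le (s : SemistarOperation R K) (E F : Submodule R K) : E * s F ≤ s (E * F) := by
  rw [Submodule.mul_le]
  intro e he y hy
  by_cases h0 : e = 0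
  · simp [h0]
  · have h1 : e * y ∈ e • s F := Submodule.smul_mem_pointwise_smul _ e _ hy
    rw [← s.smul' e h0] at h1
    refine s.mono' _ _ ?_ h1
    rintro _ ⟨z, hz, rfl⟩
    exact Submodule.mul_mem_mul he hz

theorem one_mem (s : SemistarOperation R K) : (1 : K) ∈ s 1 :=
  s.le' 1 (Submodule.one_le.mp le_rfl)

theorem eq_one_of_mem (s : SemistarOperation R K) {E : Submodule R K} (h : E ≤ 1)
    (h1 : (1 : K) ∈ s E) : s E = s 1 := by
  refine le_antisymm (s.mono' _ _ h) ?_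
  rw [← s.idem' E]
  exact s.mono' _ _ (Submodule.one_le.mpr h1)

theorem mul_eq_one (s : SemistarOperation R K) {E F : Submodule R K}
    (hE : E ≤ 1) (hF : F ≤ 1) (hsE : s E = s 1) (hsF : s F = s 1) : s (E * F) = s 1 := by
  refine s.eq_one_of_mem ((mul_le_mul' hE hF).trans (one_mul 1).le) ?_
  have h : E ≤ s (E * F) := by
    refine le_trans ?_ (s.mul_le E F)
    rw [hsF]
    exact le_mul_of_one_le_right' (s.le' 1)
  have := s.mono' _ _ h
  rw [s.idem', hsE] at this
  exact this s.one_mem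

/-- The overring `R^⋆` of `R`. -/
def ring (s : SemistarOperation R K) : Subalgebra R K where
  carrier := s 1
  mul_mem' {a b} ha hb := by
    have h : s 1 * s 1 ≤ s 1 := by
      have := s.mul_le (s 1) 1
      rwa [mul_one, s.idem'] at this
    exact h (Submodule.mul_mem_mul ha hb)
  add_mem' ha hb := add_mem ha hb
  algebraMap_mem' r := s.le' 1 (Submodule.algebraMap_mem r)

/-- `E^{⋆_f}`, the union of all `F^⋆` with `F ⊆ E` finitely generated and nonzero (the union is
directed, hence it is the supremum). -/
def finiteType (s : SemistarOperation R K) (E : Submodule R K) : Submodule R K :=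
  ⨆ F : {F : Submodule R K // F.FG ∧ F ≠ ⊥ ∧ F ≤ E}, s F.1

theorem coeSubmodule_le_one (J : Ideal R) : IsLocalization.coeSubmodule K J ≤ 1 := by
  rw [← IsLocalization.coeSubmodule_top]
  exact Submodule.map_mono le_top

/-- The nonzero finitely generated ideals `J` of `R` with `J^⋆ = R^⋆`. -/
def IsDense (s : SemistarOperation R K) (J : Ideal R) : Prop :=
  J.FG ∧ J ≠ ⊥ ∧ s (IsLocalization.coeSubmodule K J) = s 1

theorem ne_bot_of_eq_one (s : SemistarOperation R K) {J : Ideal R}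
    (h : s (IsLocalization.coeSubmodule K J) = s 1) : J ≠ ⊥ := by
  rintro rfl
  rw [IsLocalization.coeSubmodule_bot, s.bot'] at h
  have := s.one_mem
  rw [← h] at this
  simp at this

theorem isDense_top (s : SemistarOperation R K) : s.IsDense ⊤ := by
  have h : s (IsLocalization.coeSubmodule K (⊤ : Ideal R)) = s 1 := by
    rw [IsLocalization.coeSubmodule_top]
  exact ⟨Ideal.fg_top R, s.ne_bot_of_eq_one h, h⟩

theorem IsDense.mul {s : SemistarOperation R K} {I J : Ideal R} (hI : s.IsDense I)
    (hJ : s.IsDense J) : s.IsDense (I * J) := by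
  have h : s (IsLocalization.coeSubmodule K (I * J)) = s 1 := by
    rw [IsLocalization.coeSubmodule_mul]
    exact s.mul_eq_one (coeSubmodule_le_one I) (coeSubmodule_le_one J) hI.2.2 hJ.2.2
  exact ⟨hI.1.mul hJ.1, s.ne_bot_of_eq_one h, h⟩

/-- `E^{⋆̃} = {x ∈ K | x J ⊆ E for some finitely generated J ⊆ R with J^⋆ = R^⋆}`. -/
def tildeFun (s : SemistarOperation R K) (E : Submodule R K) : Submodule R K where
  carrier := {x | ∃ J : Ideal R, s.IsDense J ∧ ∀ y ∈ J, x * algebraMap R K y ∈ E}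
  zero_mem' := ⟨⊤, s.isDense_top, by simp⟩
  add_mem' := by
    rintro a b ⟨I, hI, ha⟩ ⟨J, hJ, hb⟩
    refine ⟨I * J, hI.mul hJ, fun y hy => ?_⟩
    rw [add_mul]
    exact add_mem (ha y (Ideal.mul_le_left hy)) (hb y (Ideal.mul_le_right hy))
  smul_mem' := by
    rintro r a ⟨I, hI, ha⟩
    refine ⟨I, hI, fun y hy => ?_⟩
    rw [smul_mul_assoc]
    exact E.smul_mem r (ha y hy)

theorem exists_uniform_isDense (s : SemistarOperation R K) (E : Submodule R K) (x : K)
    (J : Ideal R) (hJ : J.FG) (h : ∀ y ∈ J, x * algebraMap R K y ∈ s.tildeFun E) :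
    ∃ I : Ideal R, s.IsDense I ∧
      ∀ y ∈ J, ∀ z ∈ I, x * algebraMap R K y * algebraMap R K z ∈ E := by
  induction J, hJ using Submodule.fg_induction with
  | singleton a =>
    obtain ⟨I, hI, hz⟩ := h a (Submodule.mem_span_singleton_self a)
    refine ⟨I, hI, fun y hy z hzI => ?_⟩
    obtain ⟨r, rfl⟩ := Submodule.mem_span_singleton.mp hy
    have := E.smul_mem r (hz z hzI)
    rw [Algebra.smul_def] at this
    convert this using 1
    simp only [smul_eq_mul, map_mul]
    ring
  | sup J₁ J₂ _ _ h₁ h₂ =>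
    obtain ⟨I₁, hI₁, hz₁⟩ := h₁ fun y hy => h y (Submodule.mem_sup_left hy)
    obtain ⟨I₂, hI₂, hz₂⟩ := h₂ fun y hy => h y (Submodule.mem_sup_right hy)
    refine ⟨I₁ * I₂, hI₁.mul hI₂, fun y hy z hz => ?_⟩
    obtain ⟨a, ha, b, hb, rfl⟩ := Submodule.mem_sup.mp hy
    rw [map_add, mul_add, add_mul]
    exact add_mem (hz₁ a ha z (Ideal.mul_le_left hz)) (hz₂ b hb z (Ideal.mul_le_right hz))

/-- The semistar operation `⋆̃` associated to `⋆`. -/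
def tilde [FaithfulSMul R K] (s : SemistarOperation R K) : SemistarOperation R K where
  toFun := s.tildeFun
  bot' := by
    rw [eq_bot_iff]
    rintro x ⟨J, hJ, hx⟩
    obtain ⟨y, hy, hy0⟩ := Submodule.exists_mem_ne_zero_of_ne_bot hJ.2.1
    have h := hx y hy
    simpa [hy0] using h
  smul' := by
    intro x hx E
    ext y
    rw [mem_smul_iff hx]
    constructor
    · rintro ⟨J, hJ, h⟩
      refine ⟨J, hJ, fun z hz => ?_⟩
      rw [mul_assoc]
      exact (mem_smul_iff hx _ _).mp (h z hz)
    · rintro ⟨J, hJ, h⟩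
      refine ⟨J, hJ, fun z hz => ?_⟩
      rw [mem_smul_iff hx, ← mul_assoc]
      exact h z hz
  mono' := by
    rintro E F hEF x ⟨J, hJ, h⟩
    exact ⟨J, hJ, fun y hy => hEF (h y hy)⟩
  le' := by
    intro E x hx
    refine ⟨⊤, s.isDense_top, fun y _ => ?_⟩
    rw [mul_comm, ← Algebra.smul_def]
    exact E.smul_mem y hx
  idem' := by
    intro E
    refine le_antisymm ?_ ?_
    · rintro x ⟨J, hJ, h⟩
      obtain ⟨I, hI, hI'⟩ := s.exists_uniform_isDense E x J hJ.1 h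
      refine ⟨J * I, hJ.mul hI, fun y hy => ?_⟩
      refine Submodule.mul_induction_on hy (fun a ha b hb => ?_) (fun a b ha hb => ?_)
      · rw [map_mul, ← mul_assoc]
        exact hI' a ha b hb
      · rw [map_add, mul_add]
        exact add_mem ha hb
    · intro x hx
      refine ⟨⊤, s.isDense_top, fun y _ => ?_⟩
      rw [mul_comm, ← Algebra.smul_def]
      exact (s.tildeFun E).smul_mem y hx

/-- For `F` finitely generated, `F^{⋆_a}` is the (directed) union of the modules
`((F G)^⋆ : G^⋆)`, with `G` running over the nonzero finitely generated submodules of `K`. -/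
def eabFG (s : SemistarOperation R K) (F : Submodule R K) : Submodule R K :=
  ⨆ G : {G : Submodule R K // G.FG ∧ G ≠ ⊥}, s (F * G.1) / s G.1

/-- `E^{⋆_a}`, for the e.a.b. semistar operation `⋆_a` associated to `⋆`: the (directed) union of
the `F^{⋆_a}` with `F ⊆ E` finitely generated and nonzero. -/
def eab (s : SemistarOperation R K) (E : Submodule R K) : Submodule R K :=
  ⨆ F : {F : Submodule R K // F.FG ∧ F ≠ ⊥ ∧ F ≤ E}, s.eabFG F.1

end SemistarOperation

/-- A Prüfer domain: a domain whose nonzero finitely generated ideals are all invertible. -/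
def IsPruferDomain (D : Type*) [CommRing D] : Prop :=
  IsDomain D ∧ ∀ I : Ideal D, I.FG → I ≠ ⊥ →
    IsUnit (I : FractionalIdeal D⁰ (FractionRing D))

/-! ### Graded domains -/

theorem uniqueSums_of_torsionFree (Γ : Type*) [AddCancelCommMonoid Γ] [IsAddTorsionFree Γ] :
    UniqueSums Γ where
  uniqueAdd_of_nonempty {A B} hA hB := by
    classical
    let M := AddSubmonoid.closure ((A ∪ B : Finset Γ) : Set Γ)
    have hAM : ∀ a ∈ A, a ∈ M := fun a ha =>
      AddSubmonoid.subset_closure (by simp [ha])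
    have hBM : ∀ b ∈ B, b ∈ M := fun b hb =>
      AddSubmonoid.subset_closure (by simp [hb])
    have : AddMonoid.FG M := (AddMonoid.fg_iff_addSubmonoid_fg M).mpr ⟨A ∪ B, rfl⟩
    have : IsAddTorsionFree M := Subtype.val_injective.isAddTorsionFree M.subtype
    let _ : AddCancelCommMonoid M :=
      { (inferInstance : AddCommMonoid M) with
        add_left_cancel := fun a b c h =>
          Subtype.ext (add_left_cancel (congrArg Subtype.val h)) }
    have : UniqueSums M := (AffineAddMonoid.to_twoUniqueSums (M := M)).toUniqueSums
    obtain ⟨a, ha, b, hb, hu⟩ := UniqueSums.uniqueAdd_of_nonempty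
      (A := A.subtype (· ∈ M)) (B := B.subtype (· ∈ M))
      (by obtain ⟨a, ha⟩ := hA; exact ⟨⟨a, hAM a ha⟩, by simpa using ha⟩)
      (by obtain ⟨b, hb⟩ := hB; exact ⟨⟨b, hBM b hb⟩, by simpa using hb⟩)
    refine ⟨a.1, by simpa using ha, b.1, by simpa using hb, fun x y hx hy hxy => ?_⟩
    have := hu (a := ⟨x, hAM x hx⟩) (b := ⟨y, hBM y hy⟩) (by simpa using hx) (by simpa using hy)
      (Subtype.ext hxy)
    exact ⟨congrArg Subtype.val this.1, congrArg Subtype.val this.2⟩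

namespace GradedDomain

variable {Γ R : Type*} [AddCancelCommMonoid Γ] [DecidableEq Γ] [CommRing R]
variable (𝒜 : Γ → AddSubgroup R) [GradedRing 𝒜]

/-- The ideal `C(f)` of `R` generated by the homogeneous components of `f`. -/
def content (f : R) : Ideal R :=
  Ideal.span (Set.range fun α => (DirectSum.decompose 𝒜 f α : R))

theorem content_fg (f : R) : (content 𝒜 f).FG := by
  classical
  refine ⟨insert 0 ((DirectSum.decompose 𝒜 f).support.image
    fun α => (DirectSum.decompose 𝒜 f α : R)), ?_⟩
  refine le_antisymm (Submodule.span_le.mpr ?_) (Submodule.span_le.mpr ?_)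
  · intro x hx
    simp only [Finset.coe_insert, Finset.coe_image, Set.mem_insert_iff, Set.mem_image] at hx
    rcases hx with rfl | ⟨α, -, rfl⟩
    · exact zero_mem _
    · exact Ideal.subset_span ⟨α, rfl⟩
  · rintro _ ⟨α, rfl⟩
    refine Submodule.subset_span ?_
    by_cases h : DirectSum.decompose 𝒜 f α = 0
    · simp [h]
    · simp only [Finset.coe_insert, Finset.coe_image, Set.mem_insert_iff, Set.mem_image]
      exact Or.inr ⟨α, by simpa using h, rfl⟩

theorem content_one : content 𝒜 (1 : R) = ⊤ := by
  rw [Ideal.eq_top_iff_one]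
  refine Ideal.subset_span ⟨0, ?_⟩
  exact DirectSum.decompose_of_mem_same 𝒜 SetLike.GradedOne.one_mem

theorem content_le_or_le_of_mul [IsAddTorsionFree Γ] (P : Ideal R) [hP : P.IsPrime] (f g : R)
    (h : content 𝒜 (f * g) ≤ P) : content 𝒜 f ≤ P ∨ content 𝒜 g ≤ P := by
  classical
  have := uniqueSums_of_torsionFree Γ
  by_contra hcon
  rw [not_or] at hcon
  have key : ∀ f : R, ¬ content 𝒜 f ≤ P → ((DirectSum.decompose 𝒜 f).support.filter
      fun α => (DirectSum.decompose 𝒜 f α : R) ∉ P).Nonempty := by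
    intro f hf
    rw [content, Ideal.span_le, Set.not_subset] at hf
    obtain ⟨_, ⟨α, rfl⟩, hα⟩ := hf
    refine ⟨α, Finset.mem_filter.mpr ⟨?_, hα⟩⟩
    rw [DFinsupp.mem_support_toFun]
    intro h0
    refine hα ?_
    simp [h0]
  obtain ⟨i, hi, j, hj, hu⟩ :=
    UniqueSums.uniqueAdd_of_nonempty (key f hcon.1) (key g hcon.2)
  have hmem : (DirectSum.decompose 𝒜 (f * g) (i + j) : R) ∈ P :=
    h (Ideal.subset_span ⟨i + j, rfl⟩)
  rw [DirectSum.decompose_mul, DirectSum.coe_mul_apply,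
    ← Finset.add_sum_erase _ _ (a := (i, j)) (by
      simp only [Finset.mem_filter, Finset.mem_product]
      exact ⟨⟨(Finset.mem_filter.mp hi).1, (Finset.mem_filter.mp hj).1⟩, trivial⟩)] at hmem
  have hrest : ∑ x ∈ (Finset.filter (fun x : Γ × Γ => x.1 + x.2 = i + j)
      ((DirectSum.decompose 𝒜 f).support ×ˢ (DirectSum.decompose 𝒜 g).support)).erase (i, j),
      (DirectSum.decompose 𝒜 f x.1 : R) * (DirectSum.decompose 𝒜 g x.2 : R) ∈ P := by
    refine Ideal.sum_mem _ fun x hx => ?_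
    simp only [Finset.mem_erase, Finset.mem_filter, Finset.mem_product] at hx
    obtain ⟨hne, ⟨h1, h2⟩, h3⟩ := hx
    by_contra hc
    have ha : (DirectSum.decompose 𝒜 f x.1 : R) ∉ P := fun h' => hc (P.mul_mem_right _ h')
    have hb : (DirectSum.decompose 𝒜 g x.2 : R) ∉ P := fun h' => hc (P.mul_mem_left _ h')
    have := hu (Finset.mem_filter.mpr ⟨h1, ha⟩) (Finset.mem_filter.mpr ⟨h2, hb⟩) h3
    exact hne (Prod.ext this.1 this.2)
  have hprod := (Ideal.add_mem_iff_left P hrest).mp hmem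
  rcases hP.mem_or_mem hprod with h' | h'
  · exact (Finset.mem_filter.mp hi).2 h'
  · exact (Finset.mem_filter.mp hj).2 h'

theorem exists_content_pow_le [IsAddTorsionFree Γ] (f g : R) :
    ∃ n : ℕ, (content 𝒜 f * content 𝒜 g) ^ n ≤ content 𝒜 (f * g) := by
  refine Ideal.exists_pow_le_of_le_radical_of_fg ?_ ((content_fg 𝒜 f).mul (content_fg 𝒜 g))
  rw [Ideal.radical_eq_sInf]
  refine le_sInf fun P hP => ?_
  have := hP.2
  rcases content_le_or_le_of_mul 𝒜 P f g hP.1 with h | h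
  · exact Ideal.mul_le_left.trans h
  · exact Ideal.mul_le_right.trans h

/-- The multiplicative set `H` of nonzero homogeneous elements of `R`. -/
def homogeneousElements [IsDomain R] : Submonoid R where
  carrier := {a | SetLike.IsHomogeneousElem 𝒜 a ∧ a ≠ 0}
  one_mem' := ⟨SetLike.isHomogeneousElem_one 𝒜, one_ne_zero⟩
  mul_mem' ha hb := ⟨ha.1.mul hb.1, mul_ne_zero ha.2 hb.2⟩

variable {K : Type*} [Field K] [Algebra R K]

/-- The multiplicative set `N_⋆(H) = {f ∈ R | C(f)^⋆ = R^⋆}`. -/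
def nagataSet [IsAddTorsionFree Γ] (s : SemistarOperation R K) : Submonoid R where
  carrier := {f | s (IsLocalization.coeSubmodule K (content 𝒜 f)) = s 1}
  one_mem' := by
    simp only [Set.mem_ofPred_eq, content_one, IsLocalization.coeSubmodule_top]
  mul_mem' {f g} hf hg := by
    have hf' : s.IsDense (content 𝒜 f) := ⟨content_fg 𝒜 f, s.ne_bot_of_eq_one hf, hf⟩
    have hg' : s.IsDense (content 𝒜 g) := ⟨content_fg 𝒜 g, s.ne_bot_of_eq_one hg, hg⟩
    obtain ⟨n, hn⟩ := exists_content_pow_le 𝒜 f g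
    have hpow : ∀ n : ℕ, s.IsDense ((content 𝒜 f * content 𝒜 g) ^ n) := by
      intro n
      induction n with
      | zero => simpa using s.isDense_top
      | succ n ih => rw [pow_succ]; exact ih.mul (hf'.mul hg')
    refine s.eq_one_of_mem (SemistarOperation.coeSubmodule_le_one _) ?_
    refine s.mono' _ _ (Submodule.map_mono hn) ?_
    have := (hpow n).2.2
    rw [IsLocalization.coeSubmodule] at this
    rw [this]
    exact s.one_mem

variable [IsDomain R]

theorem homogeneousElements_le : homogeneousElements 𝒜 ≤ R⁰ :=
  fun _ ha => mem_nonZeroDivisors_of_ne_zero ha.2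

theorem nagataSet_le [IsAddTorsionFree Γ] (s : SemistarOperation R K) :
    nagataSet 𝒜 s ≤ R⁰ := by
  intro f hf
  refine mem_nonZeroDivisors_of_ne_zero ?_
  rintro rfl
  refine s.ne_bot_of_eq_one hf ?_
  simp [content]

variable [IsFractionRing R K]

variable (K) in
/-- The homogeneous quotient field `R_H`, inside `K`. -/
noncomputable def homogeneousQuotientField : Subalgebra R K :=
  Localization.subalgebra.ofField K (homogeneousElements 𝒜) (homogeneousElements_le 𝒜)

/-- The graded Nagata ring `R_{N_⋆(H)}`, inside `K`. -/
noncomputable def nagataRing [IsAddTorsionFree Γ] (s : SemistarOperation R K) : Subalgebra R K :=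
  Localization.subalgebra.ofField K (nagataSet 𝒜 s) (nagataSet_le 𝒜 s)

/-- The elements of the graded Kronecker function ring `Kr(R, ⋆)`: the fractions `f / g` with
`f, g ∈ R`, `g ≠ 0`, such that `C(f) C(h) ⊆ (C(g) C(h))^⋆` for some nonzero `h ∈ R`. -/
def kroneckerSet (s : SemistarOperation R K) : Set K :=
  {x | ∃ f g : R, g ≠ 0 ∧ x = algebraMap R K f / algebraMap R K g ∧ ∃ h : R, h ≠ 0 ∧
    IsLocalization.coeSubmodule K (content 𝒜 f * content 𝒜 h) ≤
      s (IsLocalization.coeSubmodule K (content 𝒜 g * content 𝒜 h))}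

/-- `R` is a graded Prüfer `⋆`-multiplication domain: `(I I⁻¹)^{⋆_f} = R^⋆` for every nonzero
finitely generated homogeneous ideal `I`, where `I⁻¹ = (R : I)`. -/
def IsGradedPStarMD (s : SemistarOperation R K) : Prop :=
  ∀ I : Ideal R, I.IsHomogeneous 𝒜 → I.FG → I ≠ ⊥ →
    s.finiteType (IsLocalization.coeSubmodule K I * (1 / IsLocalization.coeSubmodule K I)) = s 1

end GradedDomain

/-! The proof works with finitely generated homogeneous ideals through contents of single elements.
Multiplying by powers of the homogeneous unit pulls the supports of two elements apart, so every
such ideal is a content `C(f)`, and the Dedekind–Mertens formula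
`C(f)ⁿ⁺¹ C(g) = C(f)ⁿ C(f g)` makes contents multiplicative up to a common factor.

An ideal `C(f)` is `⋆_f`-invertible exactly when it becomes principal, generated by `f`, in the
graded Nagata ring; in that case the homogeneous ideals determine all ideals of that ring, which is
then Bézout and equal to the Kronecker function ring. Conversely, if the Kronecker
function ring is flat, extension to it commutes with the colon ideal `(f : C(f))`; as `C(f)` is
principal there, `(f : C(f))` extends to the unit ideal, which makes `C(f)` invertible. If `⋆̃` and
`⋆̃_a` agree, then for homogeneous `a` and `b` some `z ∈ N_⋆(H)` satisfies `z a b = l a² + m b²`;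
the fractions `l a / b` and `m b / a` are integral over `R`, and show that `(a, b)` is invertible.

For the last claim, an element integral over `R` lies in `R_H` by a `ℚ`-valued regrading, and the
elements of `R_H` in the graded Nagata ring belong to `R^⋆̃`. -/

theorem exists_forall_forall_add_nsmul_ne {M : Type*} [AddCancelCommMonoid M] [IsAddTorsionFree M]
    {a : M} (ha : a ≠ 0) (S T : Finset M) : ∃ k : ℕ, ∀ i ∈ S, ∀ j ∈ T, j + k • a ≠ i := by
  by_contra! h
  choose i hi j hj hij using h
  obtain ⟨k, l, hkl, heq⟩ := Finite.exists_ne_map_eq_of_infinite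
    fun k : ℕ => ((⟨i k, hi k⟩, ⟨j k, hj k⟩) : S × T)
  simp only [Prod.mk.injEq, Subtype.mk.injEq] at heq
  refine hkl ((IsAddLeftRegular.all a).nsmul_injective ha (add_left_cancel (a := j k) ?_))
  rw [hij k, heq.1, heq.2, hij l]

namespace GradedDomain

/-! ### The content of an element -/

section Content

variable {Γ R : Type*} [AddCancelCommMonoid Γ] [DecidableEq Γ] [CommRing R]
variable (𝒜 : Γ → AddSubgroup R)

/-- The ring has a unit that is homogeneous of nonzero degree. -/
def HasUnitOfNonzeroDegree : Prop :=
  ∃ α : Γ, α ≠ 0 ∧ ∃ u ∈ 𝒜 α, IsUnit u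

variable [GradedRing 𝒜]

theorem decompose_mem_content (f : R) (α : Γ) :
    (DirectSum.decompose 𝒜 f α : R) ∈ content 𝒜 f :=
  Ideal.subset_span ⟨α, rfl⟩

variable {𝒜} in
theorem exists_decompose_ne_zero {f : R} (hf : f ≠ 0) : ∃ α, DirectSum.decompose 𝒜 f α ≠ 0 := by
  by_contra! h
  exact hf ((DirectSum.decompose 𝒜).injective
    (DFinsupp.ext fun α => by rw [h α, DirectSum.decompose_zero, DirectSum.zero_apply]))

theorem isHomogeneousElem_decompose (f : R) (α : Γ) :
    SetLike.IsHomogeneousElem 𝒜 (DirectSum.decompose 𝒜 f α : R) :=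
  ⟨α, SetLike.coe_mem _⟩

theorem content_isHomogeneous (f : R) : (content 𝒜 f).IsHomogeneous 𝒜 := by
  refine Ideal.homogeneous_span 𝒜 _ ?_
  rintro _ ⟨α, rfl⟩
  exact isHomogeneousElem_decompose 𝒜 f α

theorem content_pow_isHomogeneous (f : R) (n : ℕ) : (content 𝒜 f ^ n).IsHomogeneous 𝒜 := by
  induction n with
  | zero => simpa only [pow_zero, Ideal.one_eq_top] using Ideal.IsHomogeneous.top 𝒜
  | succ n ih => exact pow_succ (content 𝒜 f) n ▸ ih.mul (content_isHomogeneous 𝒜 f)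

theorem mem_content_self (f : R) : f ∈ content 𝒜 f := by
  classical
  have h := Ideal.sum_mem (content 𝒜 f) (t := (DirectSum.decompose 𝒜 f).support)
    fun α _ => decompose_mem_content 𝒜 f α
  rwa [DirectSum.sum_support_decompose] at h

variable {𝒜}

theorem content_le_iff {I : Ideal R} (hI : I.IsHomogeneous 𝒜) {f : R} :
    content 𝒜 f ≤ I ↔ f ∈ I := by
  refine ⟨fun h => h (mem_content_self 𝒜 f), fun h => Ideal.span_le.mpr ?_⟩
  rintro _ ⟨α, rfl⟩
  exact hI α h

theorem content_of_isHomogeneousElem {a : R} (ha : SetLike.IsHomogeneousElem 𝒜 a) :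
    content 𝒜 a = Ideal.span {a} := by
  refine le_antisymm ?_ ((Ideal.span_singleton_le_iff_mem _).mpr (mem_content_self 𝒜 a))
  exact (content_le_iff (Ideal.homogeneous_span 𝒜 _ (by rintro _ rfl; exact ha))).mpr
    (Ideal.mem_span_singleton_self a)

variable (𝒜)

theorem content_ne_bot {f : R} (hf : f ≠ 0) : content 𝒜 f ≠ ⊥ := fun h =>
  hf ((Submodule.mem_bot R).mp (h ▸ mem_content_self 𝒜 f))

@[simp]
theorem content_zero : content 𝒜 (0 : R) = ⊥ :=
  eq_bot_iff.mpr ((content_le_iff (Ideal.IsHomogeneous.bot 𝒜)).mpr (zero_mem _))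

theorem content_mul_le (f g : R) : content 𝒜 (f * g) ≤ content 𝒜 f * content 𝒜 g :=
  (content_le_iff ((content_isHomogeneous 𝒜 f).mul (content_isHomogeneous 𝒜 g))).mpr
    (Ideal.mul_mem_mul (mem_content_self 𝒜 f) (mem_content_self 𝒜 g))

theorem content_add_le (f g : R) : content 𝒜 (f + g) ≤ content 𝒜 f ⊔ content 𝒜 g :=
  (content_le_iff ((content_isHomogeneous 𝒜 f).sup (content_isHomogeneous 𝒜 g))).mpr
    (add_mem (Ideal.mem_sup_left (mem_content_self 𝒜 f))
      (Ideal.mem_sup_right (mem_content_self 𝒜 g)))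

theorem content_neg (f : R) : content 𝒜 (-f) = content 𝒜 f :=
  le_antisymm ((content_le_iff (content_isHomogeneous 𝒜 f)).mpr (neg_mem (mem_content_self 𝒜 f)))
    ((content_le_iff (content_isHomogeneous 𝒜 _)).mpr
      (neg_mem_iff.mp (mem_content_self 𝒜 (-f))))

theorem content_sub_le (f g : R) : content 𝒜 (f - g) ≤ content 𝒜 f ⊔ content 𝒜 g := by
  simpa only [sub_eq_add_neg, content_neg] using content_add_le 𝒜 f (-g)

theorem content_mul_of_isUnit (f : R) {v : R} (hv : IsUnit v) :
    content 𝒜 (f * v) = content 𝒜 f :=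
  le_antisymm
    ((content_le_iff (content_isHomogeneous 𝒜 f)).mpr
      (Ideal.mul_mem_right _ _ (mem_content_self 𝒜 f)))
    ((content_le_iff (content_isHomogeneous 𝒜 _)).mpr
      ((Ideal.mul_unit_mem_iff_mem _ hv).mp (mem_content_self 𝒜 (f * v))))

theorem content_add_eq_sup {f g : R}
    (h : ∀ α, DirectSum.decompose 𝒜 f α = 0 ∨ DirectSum.decompose 𝒜 g α = 0) :
    content 𝒜 (f + g) = content 𝒜 f ⊔ content 𝒜 g := by
  refine le_antisymm (content_add_le 𝒜 f g) (sup_le ?_ ?_) <;>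
  · refine Ideal.span_le.mpr ?_
    rintro _ ⟨α, rfl⟩
    have hα := decompose_mem_content 𝒜 (f + g) α
    rw [DirectSum.decompose_add] at hα
    rcases h α with h | h <;> simp_all

theorem exists_decompose_ne_zero_of_mul_mem {g v : R} {β α : Γ} (hv : v ∈ 𝒜 β)
    (h : DirectSum.decompose 𝒜 (g * v) α ≠ 0) :
    ∃ j, DirectSum.decompose 𝒜 g j ≠ 0 ∧ j + β = α := by
  classical
  by_contra! hcon
  refine h (Subtype.ext ?_)
  conv_lhs => rw [← DirectSum.sum_support_decompose 𝒜 g, Finset.sum_mul]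
  rw [DirectSum.decompose_sum, DFinsupp.finsetSum_apply, AddSubmonoidClass.coe_finsetSum]
  refine Finset.sum_eq_zero fun j hj => ?_
  exact DirectSum.decompose_of_mem_ne 𝒜 (SetLike.mul_mem_graded (SetLike.coe_mem _) hv)
    (hcon j (by simpa only [DFinsupp.mem_support_toFun] using hj))

theorem content_mul_span_singleton_le {a : R} (ha : SetLike.IsHomogeneousElem 𝒜 a) (f : R) :
    content 𝒜 f * Ideal.span {a} ≤ content 𝒜 (f * a) := by
  obtain ⟨i, hi⟩ := ha
  rw [content, Ideal.span_mul_span', Ideal.span_le]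
  rintro _ ⟨_, ⟨α, rfl⟩, b, rfl, rfl⟩
  have h := decompose_mem_content 𝒜 (f * b) (α + i)
  rwa [DirectSum.coe_decompose_mul_add_of_right_mem 𝒜 hi] at h

theorem colon_isHomogeneous {W L : Ideal R} (hW : W.IsHomogeneous 𝒜) (hL : L.IsHomogeneous 𝒜) :
    (W.colon (L : Set R)).IsHomogeneous 𝒜 := by
  classical
  intro i b hb
  rw [Submodule.mem_colon] at hb ⊢
  intro y hy
  rw [← DirectSum.sum_support_decompose 𝒜 y, Finset.smul_sum]
  refine Ideal.sum_mem _ fun j _ => ?_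
  have h := hW (i + j) (hb _ (hL j hy))
  rwa [smul_eq_mul, DirectSum.coe_decompose_mul_add_of_right_mem 𝒜 (SetLike.coe_mem _)] at h

variable {𝒜} in
theorem exists_isHomogeneousElem_mem {I : Ideal R} (hI : I.IsHomogeneous 𝒜) (h : I ≠ ⊥) :
    ∃ a ∈ I, SetLike.IsHomogeneousElem 𝒜 a ∧ a ≠ 0 := by
  obtain ⟨x, hx, hx0⟩ := Submodule.exists_mem_ne_zero_of_ne_bot h
  obtain ⟨i, hi⟩ := exists_decompose_ne_zero (𝒜 := 𝒜) hx0
  exact ⟨_, hI i hx, isHomogeneousElem_decompose 𝒜 x i, fun h => hi (Subtype.ext h)⟩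

variable [IsAddTorsionFree Γ]

-- Multiplying `g` by a large power of the unit moves its degrees away from those of `f`.
theorem exists_isUnit_forall_decompose_eq_zero_or (hunit : HasUnitOfNonzeroDegree 𝒜) (f g : R) :
    ∃ v : R, IsUnit v ∧
      ∀ α, DirectSum.decompose 𝒜 f α = 0 ∨ DirectSum.decompose 𝒜 (g * v) α = 0 := by
  classical
  obtain ⟨α, hα, u, hu, huu⟩ := hunit
  obtain ⟨k, hk⟩ := exists_forall_forall_add_nsmul_ne hα
    (DirectSum.decompose 𝒜 f).support (DirectSum.decompose 𝒜 g).support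
  refine ⟨u ^ k, huu.pow k, ?_⟩
  by_contra! h
  obtain ⟨γ, hfγ, hgγ⟩ := h
  obtain ⟨j, hj, hjγ⟩ :=
    exists_decompose_ne_zero_of_mul_mem 𝒜 (SetLike.pow_mem_graded k hu) hgγ
  exact hk γ (by simpa using hfγ) j (by simpa using hj) hjγ

theorem exists_content_add_mul_eq_sup (hunit : HasUnitOfNonzeroDegree 𝒜) (f g : R) :
    ∃ v : R, content 𝒜 (f + g * v) = content 𝒜 f ⊔ content 𝒜 g ∧
      content 𝒜 (f - g * v) = content 𝒜 f ⊔ content 𝒜 g := by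
  obtain ⟨v, hv, h⟩ := exists_isUnit_forall_decompose_eq_zero_or 𝒜 hunit f g
  have h' (α : Γ) : DirectSum.decompose 𝒜 f α = 0 ∨ DirectSum.decompose 𝒜 (-(g * v)) α = 0 := by
    rw [DirectSum.decompose_neg]
    exact (h α).imp_right neg_eq_zero.mpr
  refine ⟨v, ?_, ?_⟩
  · rw [content_add_eq_sup 𝒜 h, content_mul_of_isUnit 𝒜 g hv]
  · rw [sub_eq_add_neg, content_add_eq_sup 𝒜 h', content_neg, content_mul_of_isUnit 𝒜 g hv]

theorem exists_mem_le_content (hunit : HasUnitOfNonzeroDegree 𝒜) {J : Ideal R} (hJ : J.FG) :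
    ∃ r ∈ J, J ≤ content 𝒜 r := by
  induction J, hJ using Submodule.fg_induction with
  | singleton a =>
    exact ⟨a, Submodule.mem_span_singleton_self a,
      (Ideal.span_singleton_le_iff_mem _).mpr (mem_content_self 𝒜 a)⟩
  | sup J₁ J₂ _ _ h₁ h₂ =>
    obtain ⟨r₁, hr₁, h₁⟩ := h₁
    obtain ⟨r₂, hr₂, h₂⟩ := h₂
    obtain ⟨v, hv, -⟩ := exists_content_add_mul_eq_sup 𝒜 hunit r₁ r₂
    exact ⟨r₁ + r₂ * v, add_mem (Ideal.mem_sup_left hr₁)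
      (Ideal.mem_sup_right (Ideal.mul_mem_right _ _ hr₂)), hv ▸ sup_le_sup h₁ h₂⟩

variable {𝒜} in
theorem exists_content_eq (hunit : HasUnitOfNonzeroDegree 𝒜) {I : Ideal R}
    (hI : I.IsHomogeneous 𝒜) (hfg : I.FG) : ∃ r, content 𝒜 r = I := by
  obtain ⟨r, hr, h⟩ := exists_mem_le_content 𝒜 hunit hfg
  exact ⟨r, le_antisymm ((content_le_iff hI).mpr hr) h⟩

end Content

end GradedDomain

/-! ### The Dedekind–Mertens formula -/

theorem pow_succ_le_pow_succ_add_mul_pow {S : Type*} [IdemCommSemiring S] {F F₁ A : S}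
    (hF : F ≤ F₁ + A) (hF₁ : F₁ ≤ F) (n : ℕ) : F ^ (n + 1) ≤ F₁ ^ (n + 1) + A * F ^ n := by
  induction n with
  | zero => simpa using hF
  | succ n ih => calc
    F ^ (n + 2) = F ^ (n + 1) * F := pow_succ _ _
    _ ≤ F ^ (n + 1) * (F₁ + A) := mul_le_mul_right hF _
    _ = F ^ (n + 1) * F₁ + A * F ^ (n + 1) := by ring
    _ ≤ (F₁ ^ (n + 1) + A * F ^ n) * F₁ + A * F ^ (n + 1) :=
      add_le_add_left (mul_le_mul_left ih _) _
    _ = F₁ ^ (n + 2) + (A * F ^ n) * F₁ + A * F ^ (n + 1) := by ring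
    _ ≤ F₁ ^ (n + 2) + (A * F ^ n) * F + A * F ^ (n + 1) := by gcongr
    _ = F₁ ^ (n + 2) + (A * F ^ (n + 1) + A * F ^ (n + 1)) := by ring
    _ = F₁ ^ (n + 2) + A * F ^ (n + 1) := by rw [add_idem]

-- The induction step of the Dedekind–Mertens formula: `F`, `X`, `P` are the contents of `f`, `x`,
-- `f x`, and `F₁`, `X₁` those of `f - a`, `x - b`, where `a`, `b` are homogeneous components.
theorem pow_mul_le_pow_mul_of_le_add {S : Type*} [IdemCommSemiring S] {F F₁ A X X₁ B P : S}
    (m : ℕ) (hF : F ≤ F₁ + A) (hF₁ : F₁ ≤ F) (hA : A ≤ F) (hX : X ≤ X₁ + B) (hAB : A * B ≤ P)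
    (h₁ : F ^ (m + 1) * X₁ ≤ F ^ m * (P + B * F))
    (h₂ : F₁ ^ (m + 2) * X ≤ F₁ ^ (m + 1) * (P + A * X)) :
    F ^ (m + 2) * X ≤ F ^ (m + 1) * P := by
  have hFX : F ^ (m + 1) * X ≤ F ^ m * P + B * F ^ (m + 1) := calc
    F ^ (m + 1) * X ≤ F ^ (m + 1) * X₁ + F ^ (m + 1) * B := by
      rw [← mul_add]; exact mul_le_mul_right hX _
    _ ≤ F ^ m * (P + B * F) + F ^ (m + 1) * B := add_le_add_left h₁ _
    _ = F ^ m * P + (B * F ^ (m + 1) + B * F ^ (m + 1)) := by ring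
    _ = F ^ m * P + B * F ^ (m + 1) := by rw [add_idem]
  have hAFX : A * (F ^ (m + 1) * X) ≤ F ^ (m + 1) * P := calc
    A * (F ^ (m + 1) * X) ≤ A * (F ^ m * P + B * F ^ (m + 1)) := mul_le_mul_right hFX _
    _ = A * (F ^ m * P) + F ^ (m + 1) * (A * B) := by ring
    _ ≤ F * (F ^ m * P) + F ^ (m + 1) * P :=
      add_le_add (mul_le_mul_left hA _) (mul_le_mul_right hAB _)
    _ = F ^ (m + 1) * P + F ^ (m + 1) * P := by ring
    _ = F ^ (m + 1) * P := add_idem _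
  have hF₁X : F₁ ^ (m + 2) * X ≤ F ^ (m + 1) * P := calc
    F₁ ^ (m + 2) * X ≤ F₁ ^ (m + 1) * (P + A * X) := h₂
    _ ≤ F ^ (m + 1) * (P + A * X) := mul_le_mul_left (pow_le_pow_left' hF₁ _) _
    _ = F ^ (m + 1) * P + A * (F ^ (m + 1) * X) := by ring
    _ ≤ F ^ (m + 1) * P + F ^ (m + 1) * P := add_le_add_right hAFX _
    _ = F ^ (m + 1) * P := add_idem _
  calc
    F ^ (m + 2) * X ≤ (F₁ ^ (m + 2) + A * F ^ (m + 1)) * X := mul_le_mul_left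
      (pow_succ_le_pow_succ_add_mul_pow hF hF₁ (m + 1)) _
    _ = F₁ ^ (m + 2) * X + A * (F ^ (m + 1) * X) := by ring
    _ ≤ F ^ (m + 1) * P + F ^ (m + 1) * P := add_le_add hF₁X hAFX
    _ = F ^ (m + 1) * P := add_idem _

namespace GradedDomain

section DedekindMertens

variable {Γ R : Type*} [AddCancelCommMonoid Γ] [DecidableEq Γ] [CommRing R]
variable (𝒜 : Γ → AddSubgroup R) [GradedRing 𝒜]

/-- The number of nonzero homogeneous components of an element, the quantity on which the
Dedekind–Mertens lemma is proved by induction. -/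
noncomputable def numComponents (f : R) : ℕ :=
  {α | DirectSum.decompose 𝒜 f α ≠ 0}.ncard

theorem finite_setOf_decompose_ne_zero (f : R) : {α | DirectSum.decompose 𝒜 f α ≠ 0}.Finite :=
  DFinsupp.finite_support (DirectSum.decompose 𝒜 f)

theorem numComponents_sub_lt {f : R} {i : Γ} (hi : DirectSum.decompose 𝒜 f i ≠ 0) :
    numComponents 𝒜 (f - DirectSum.decompose 𝒜 f i) < numComponents 𝒜 f := by
  have hz : DirectSum.decompose 𝒜 (f - DirectSum.decompose 𝒜 f i) i = 0 := by
    rw [DirectSum.decompose_sub, DirectSum.sub_apply, DirectSum.decompose_coe,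
      DirectSum.of_eq_same, sub_self]
  refine Set.ncard_lt_ncard ⟨fun α hα h0 => hα ?_, fun h => h hi hz⟩
    (finite_setOf_decompose_ne_zero 𝒜 f)
  rcases eq_or_ne α i with rfl | hne
  · exact hz
  · rw [DirectSum.decompose_sub, DirectSum.sub_apply, h0, DirectSum.decompose_coe,
      DirectSum.of_eq_of_ne _ _ _ hne, sub_zero]

theorem isHomogeneousElem_of_numComponents_le_one {f : R} (hf : f ≠ 0)
    (h : numComponents 𝒜 f ≤ 1) : SetLike.IsHomogeneousElem 𝒜 f := by
  obtain ⟨i, hi⟩ := exists_decompose_ne_zero (𝒜 := 𝒜) hf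
  suffices hfi : f - DirectSum.decompose 𝒜 f i = 0 from
    sub_eq_zero.mp hfi ▸ isHomogeneousElem_decompose 𝒜 f i
  by_contra hfi
  obtain ⟨j, hj⟩ := exists_decompose_ne_zero (𝒜 := 𝒜) hfi
  have hlt := numComponents_sub_lt 𝒜 hi
  have hlt' := numComponents_sub_lt 𝒜 hj
  omega

theorem content_le_sub_decompose_sup (f : R) (i : Γ) :
    content 𝒜 f ≤ content 𝒜 (f - DirectSum.decompose 𝒜 f i) ⊔
      Ideal.span {(DirectSum.decompose 𝒜 f i : R)} := by
  have h := content_add_le 𝒜 (f - DirectSum.decompose 𝒜 f i) (DirectSum.decompose 𝒜 f i : R)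
  rwa [sub_add_cancel, content_of_isHomogeneousElem (isHomogeneousElem_decompose 𝒜 f i)] at h

theorem content_mul_sub_le (f x : R) {b : R} (hb : SetLike.IsHomogeneousElem 𝒜 b) :
    content 𝒜 (f * (x - b)) ≤ content 𝒜 (f * x) ⊔ Ideal.span {b} * content 𝒜 f := by
  rw [mul_sub, ← content_of_isHomogeneousElem hb, mul_comm (content 𝒜 b)]
  exact (content_sub_le 𝒜 _ _).trans (sup_le_sup_left (content_mul_le 𝒜 f b) _)

variable [IsAddTorsionFree Γ]

theorem exists_decompose_mul_eq {f x : R} (hf : f ≠ 0) (hx : x ≠ 0) :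
    ∃ i j, DirectSum.decompose 𝒜 f i ≠ 0 ∧ DirectSum.decompose 𝒜 x j ≠ 0 ∧
      (DirectSum.decompose 𝒜 (f * x) (i + j) : R) =
        DirectSum.decompose 𝒜 f i * DirectSum.decompose 𝒜 x j := by
  classical
  have := uniqueSums_of_torsionFree Γ
  have hne (y : R) (hy : y ≠ 0) : (DirectSum.decompose 𝒜 y).support.Nonempty :=
    (exists_decompose_ne_zero hy).imp fun _ => DFinsupp.mem_support_iff.mpr
  obtain ⟨i, hi, j, hj, hu⟩ := UniqueSums.uniqueAdd_of_nonempty (hne f hf) (hne x hx)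
  refine ⟨i, j, by simpa using hi, by simpa using hj, ?_⟩
  rw [DirectSum.decompose_mul, DirectSum.coe_mul_apply]
  refine Finset.sum_eq_single (i, j) (fun p hp hne => ?_) fun h => ?_
  · simp only [Finset.mem_filter, Finset.mem_product] at hp
    exact absurd (Prod.ext_iff.mpr (hu hp.1.1 hp.1.2 hp.2)) hne
  · exact (h (Finset.mem_filter.mpr ⟨Finset.mem_product.mpr ⟨hi, hj⟩, rfl⟩)).elim

-- The Dedekind–Mertens lemma; removing from `f` and `x` two components whose product is a
-- component of `f * x` reduces the claim to fewer components.
theorem content_pow_mul_content_le {m : ℕ} {f x : R} (h : numComponents 𝒜 x ≤ m + 1) :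
    content 𝒜 f ^ (m + 1) * content 𝒜 x ≤ content 𝒜 f ^ m * content 𝒜 (f * x) := by
  induction m generalizing f x with
  | zero =>
    rcases eq_or_ne x 0 with rfl | hx
    · simp
    have hx' := isHomogeneousElem_of_numComponents_le_one 𝒜 hx h
    simpa only [zero_add, pow_one, pow_zero, one_mul, content_of_isHomogeneousElem hx'] using
      content_mul_span_singleton_le 𝒜 hx' f
  | succ m ihm =>
  induction hn : numComponents 𝒜 f using Nat.strong_induction_on generalizing f with
  | _ n ihn =>
  subst hn
  rcases eq_or_ne x 0 with rfl | hx
  · simp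
  rcases eq_or_ne f 0 with rfl | hf
  · simp
  obtain ⟨i, j, hi, hj, hij⟩ := exists_decompose_mul_eq 𝒜 hf hx
  have hfi := isHomogeneousElem_decompose 𝒜 f i
  have hxj := isHomogeneousElem_decompose 𝒜 x j
  refine pow_mul_le_pow_mul_of_le_add m (content_le_sub_decompose_sup 𝒜 f i) ?_
    ((Ideal.span_singleton_le_iff_mem _).mpr (decompose_mem_content 𝒜 f i))
    (content_le_sub_decompose_sup 𝒜 x j) ?_ ?_ ?_
  · exact (content_le_iff (content_isHomogeneous 𝒜 f)).mpr
      (sub_mem (mem_content_self 𝒜 f) (decompose_mem_content 𝒜 f i))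
  · rw [Ideal.span_singleton_mul_span_singleton, Ideal.span_singleton_le_iff_mem, ← hij]
    exact decompose_mem_content 𝒜 (f * x) (i + j)
  · refine (ihm (Nat.le_of_lt_succ ((numComponents_sub_lt 𝒜 hj).trans_le h))).trans ?_
    exact Ideal.mul_mono_right (content_mul_sub_le 𝒜 f x hxj)
  · refine (ihn _ (numComponents_sub_lt 𝒜 hi) rfl).trans (Ideal.mul_mono_right ?_)
    rw [mul_comm _ x, mul_comm f x]
    exact content_mul_sub_le 𝒜 x f hfi

variable {𝒜} in
theorem exists_content_pow_mul_content_le {W : Ideal R} (hW : W.IsHomogeneous 𝒜) {f x : R}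
    (h : f * x ∈ W) : ∃ n, content 𝒜 f ^ n * content 𝒜 x ≤ W :=
  ⟨_, (content_pow_mul_content_le 𝒜 (Nat.le_succ _)).trans
    (Ideal.mul_le_right.trans ((content_le_iff hW).mpr h))⟩

end DedekindMertens

end GradedDomain

/-! ### Invertibility with respect to a semistar operation -/

namespace SemistarOperation

variable {R K : Type*} [CommRing R] [Field K] [Algebra R K]

theorem map_eq_map_one_of_isDense (s : SemistarOperation R K) {J : Ideal R} (hJ : s.IsDense J)
    {E : Submodule R K} (hE : E ≤ 1) (hJE : IsLocalization.coeSubmodule K J ≤ E) : s E = s 1 :=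
  s.eq_one_of_mem hE (s.mono' _ _ hJE (hJ.2.2.ge s.one_mem))

theorem mul_mem_of_forall_mul_mem (s : SemistarOperation R K) {E F : Submodule R K} {q : K}
    (h : ∀ y ∈ E, q * y ∈ s F) {z : K} (hz : z ∈ s E) : q * z ∈ s F := by
  rcases eq_or_ne q 0 with rfl | hq
  · simp only [zero_mul, zero_mem]
  have hle : q • E ≤ s F := by
    rintro _ ⟨y, hy, rfl⟩
    exact h y hy
  have hmono := s.mono' _ _ hle
  rw [s.idem', s.smul' q hq] at hmono
  exact hmono (Submodule.smul_mem_pointwise_smul _ q _ hz)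

theorem exists_fg_of_mem_finiteType (s : SemistarOperation R K) {E : Submodule R K} {x : K}
    (hx : x ∈ s.finiteType E) : ∃ F : Submodule R K, F.FG ∧ F ≤ E ∧ x ∈ s F := by
  refine Submodule.iSup_induction _ (motive := fun x => ∃ F : Submodule R K,
    F.FG ∧ F ≤ E ∧ x ∈ s F) hx (fun F y hy => ⟨F.1, F.2.1, F.2.2.2, hy⟩)
    ⟨⊥, Submodule.fg_bot, bot_le, zero_mem _⟩ ?_
  rintro y z ⟨F, hF, hFE, hy⟩ ⟨G, hG, hGE, hz⟩
  exact ⟨F ⊔ G, hF.sup hG, sup_le hFE hGE,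
    add_mem (s.mono' _ _ le_sup_left hy) (s.mono' _ _ le_sup_right hz)⟩

theorem finiteType_le (s : SemistarOperation R K) (E : Submodule R K) : s.finiteType E ≤ s E :=
  iSup_le fun F => s.mono' _ _ F.2.2.2

theorem finiteType_eq_one_iff [FaithfulSMul R K] (s : SemistarOperation R K) {E : Submodule R K}
    (hE : E ≤ 1) : s.finiteType E = s 1 ↔
      ∃ J : Ideal R, s.IsDense J ∧ IsLocalization.coeSubmodule K J ≤ E := by
  have hinj := FaithfulSMul.algebraMap_injective R K
  constructor
  · intro h
    obtain ⟨F, hF, hFE, hone⟩ := s.exists_fg_of_mem_finiteType (h.ge s.one_mem)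
    have hJF : IsLocalization.coeSubmodule K (F.comap (Algebra.linearMap R K)) = F := by
      rw [IsLocalization.coeSubmodule, Submodule.map_comap_eq_of_le]
      rw [← Submodule.one_eq_range]
      exact hFE.trans hE
    refine ⟨F.comap (Algebra.linearMap R K), ⟨?_, ?_, ?_⟩, hJF.trans_le hFE⟩
    · refine (IsLocalization.coeSubmodule_fg K hinj _).mp ?_
      rwa [hJF]
    · refine s.ne_bot_of_eq_one ?_
      rw [hJF]
      exact s.eq_one_of_mem (hFE.trans hE) hone
    · rw [hJF]
      exact s.eq_one_of_mem (hFE.trans hE) hone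
  · rintro ⟨J, hJ, hJE⟩
    refine le_antisymm ((s.finiteType_le E).trans (s.mono' _ _ hE)) (hJ.2.2.ge.trans ?_)
    refine le_iSup_of_le
      ⟨IsLocalization.coeSubmodule K J, Submodule.FG.map _ hJ.1, fun hbot => ?_, hJE⟩ le_rfl
    have hone : (1 : K) ∈ s (IsLocalization.coeSubmodule K J) := hJ.2.2.ge s.one_mem
    rw [hbot, s.bot'] at hone
    exact one_ne_zero ((Submodule.mem_bot R).mp hone)

/-- The submodule `E` of `K` is `⋆_f`-invertible: `(E E⁻¹)^{⋆_f} = R^⋆`. This is phrased through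
the finitely generated ideals `J` with `J^⋆ = R^⋆`, so as to apply directly to `⋆̃`. -/
def IsStarInvertible (s : SemistarOperation R K) (E : Submodule R K) : Prop :=
  ∃ J : Ideal R, s.IsDense J ∧ IsLocalization.coeSubmodule K J ≤ E * (1 / E)

theorem isStarInvertible_iff_finiteType_eq [FaithfulSMul R K] (s : SemistarOperation R K)
    (E : Submodule R K) : s.IsStarInvertible E ↔ s.finiteType (E * (1 / E)) = s 1 :=
  (s.finiteType_eq_one_iff Submodule.mul_one_div_le_one).symm

theorem one_div_mul_one_div_le (E F : Submodule R K) : 1 / E * (1 / F) ≤ 1 / (E * F) := by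
  rw [Submodule.le_div_iff_mul_le, mul_mul_mul_comm, mul_comm (1 / E), mul_comm (1 / F)]
  exact mul_le_one' Submodule.mul_one_div_le_one Submodule.mul_one_div_le_one

theorem IsStarInvertible.mul {s : SemistarOperation R K} {E F : Submodule R K}
    (hE : s.IsStarInvertible E) (hF : s.IsStarInvertible F) : s.IsStarInvertible (E * F) := by
  obtain ⟨I, hI, hIE⟩ := hE
  obtain ⟨J, hJ, hJF⟩ := hF
  refine ⟨I * J, hI.mul hJ, ?_⟩
  calc IsLocalization.coeSubmodule K (I * J)
      = IsLocalization.coeSubmodule K I * IsLocalization.coeSubmodule K J :=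
        IsLocalization.coeSubmodule_mul K I J
    _ ≤ E * (1 / E) * (F * (1 / F)) := mul_le_mul' hIE hJF
    _ = E * F * (1 / E * (1 / F)) := mul_mul_mul_comm _ _ _ _
    _ ≤ E * F * (1 / (E * F)) := mul_le_mul' le_rfl (one_div_mul_one_div_le E F)

theorem IsStarInvertible.of_mul {s : SemistarOperation R K} {E F : Submodule R K}
    (h : s.IsStarInvertible (E * F)) : s.IsStarInvertible E := by
  obtain ⟨J, hJ, hJE⟩ := h
  refine ⟨J, hJ, hJE.trans ?_⟩
  rw [mul_assoc]
  refine mul_le_mul' le_rfl ?_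
  rw [Submodule.le_div_iff_mul_le, mul_right_comm, mul_comm F]
  exact Submodule.mul_one_div_le_one

theorem IsStarInvertible.sup_sup {s : SemistarOperation R K} {A B C : Submodule R K}
    (hAB : s.IsStarInvertible (A ⊔ B)) (hAC : s.IsStarInvertible (A ⊔ C))
    (hBC : s.IsStarInvertible (B ⊔ C)) : s.IsStarInvertible (A ⊔ (B ⊔ C)) := by
  have hle : A * B * C ≤ (A + B) * (A + C) * (B + C) := by
    rw [mul_right_comm]
    exact mul_le_mul' (mul_le_mul' le_sup_left le_sup_right) le_sup_left
  have hring : (A + B) * (A + C) * (B + C) + A * B * C =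
      (A + (B + C)) * (A * B + B * C + C * A) := by ring
  have hmul := (hAB.mul hAC).mul hBC
  simp only [← Submodule.add_eq_sup] at hmul ⊢
  refine .of_mul (F := A * B + B * C + C * A) ?_
  rwa [← hring, Submodule.add_eq_sup, sup_eq_left.mpr hle]

theorem isStarInvertible_span_insert (s : SemistarOperation R K) {T : Set K} (hT : T.Finite)
    {x : K} (h : ∀ y ∈ insert x T, ∀ z ∈ insert x T,
      s.IsStarInvertible (Submodule.span R {y, z})) :
    s.IsStarInvertible (Submodule.span R (insert x T)) := by
  induction T, hT using Set.Finite.induction_on generalizing x with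
  | empty => simpa using h x (by simp) x (by simp)
  | @insert y T _ _ ih =>
    have hxy := h x (by simp) y (by simp)
    have hxT := ih (x := x) fun a ha b hb =>
      h a (Set.insert_subset_insert (Set.subset_insert y T) ha) b
        (Set.insert_subset_insert (Set.subset_insert y T) hb)
    have hyT := ih (x := y) fun a ha b hb =>
      h a (Set.subset_insert x _ ha) b (Set.subset_insert x _ hb)
    simp only [Submodule.span_insert] at hxy hxT hyT ⊢
    exact .sup_sup hxy hxT hyT

/-! ### The operations `⋆̃` and `⋆̃_a` -/

theorem mem_eab_of_forall_mul_mem (s : SemistarOperation R K) {E G : Submodule R K} (hE : E.FG)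
    (hE0 : E ≠ ⊥) (hG : G.FG) (hG0 : G ≠ ⊥) {x : K} (h : ∀ y ∈ G, x * y ∈ s (E * G)) :
    x ∈ s.eab E := by
  have hle : s (E * G) / s G ≤ s.eab E :=
    le_iSup_of_le ⟨E, hE, hE0, le_rfl⟩
      (le_iSup (fun G : {G : Submodule R K // G.FG ∧ G ≠ ⊥} => s (E * G.1) / s G.1) ⟨G, hG, hG0⟩)
  exact hle (Submodule.mem_div_iff_forall_mul_mem.mpr fun y hy => s.mul_mem_of_forall_mul_mem h hy)

theorem le_eab (s : SemistarOperation R K) {E : Submodule R K} (hE : E.FG) (hE0 : E ≠ ⊥) :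
    s E ≤ s.eab E := by
  intro x hx
  refine s.mem_eab_of_forall_mul_mem hE hE0 (G := 1)
    ⟨{1}, by rw [Finset.coe_singleton, Submodule.one_eq_span]⟩ one_ne_zero fun y hy => ?_
  obtain ⟨r, rfl⟩ := Submodule.mem_one.mp hy
  rw [mul_one, mul_comm, ← Algebra.smul_def]
  exact (s E).smul_mem r hx

theorem isIntegral_mem_eab_one (s : SemistarOperation R K) {x : K} (hx : IsIntegral R x) :
    x ∈ s.eab 1 := by
  let G := (Algebra.adjoin R {x}).toSubmodule
  have hG0 : G ≠ ⊥ :=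
    (Submodule.ne_bot_iff G).mpr ⟨1, (Algebra.adjoin R {x}).one_mem, one_ne_zero⟩
  refine s.mem_eab_of_forall_mul_mem
    ⟨{1}, by rw [Finset.coe_singleton, Submodule.one_eq_span]⟩ one_ne_zero
    hx.fg_adjoin_singleton hG0 fun y hy => ?_
  rw [one_mul]
  exact s.le' _ ((Algebra.adjoin R {x}).mul_mem (Algebra.self_mem_adjoin_singleton R x) hy)

variable [FaithfulSMul R K]

theorem IsDense.tilde_eq {s : SemistarOperation R K} {J : Ideal R} (hJ : s.IsDense J) :
    s.tilde (IsLocalization.coeSubmodule K J) = s.tilde 1 :=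
  s.tilde.eq_one_of_mem (coeSubmodule_le_one J)
    ⟨J, hJ, fun y hy => by rw [one_mul]; exact ⟨y, hy, rfl⟩⟩

theorem exists_isDense_forall_mul_mem (s : SemistarOperation R K) {E F : Submodule R K}
    (hF : F.FG) (h : F ≤ s.tilde E) :
    ∃ J : Ideal R, s.IsDense J ∧ ∀ y ∈ F, ∀ z ∈ J, y * algebraMap R K z ∈ E := by
  induction F, hF using Submodule.fg_induction with
  | singleton a =>
    obtain ⟨I, hI, haI⟩ := h (Submodule.mem_span_singleton_self a)
    refine ⟨I, hI, fun y hy z hz => ?_⟩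
    obtain ⟨r, rfl⟩ := Submodule.mem_span_singleton.mp hy
    rw [smul_mul_assoc]
    exact E.smul_mem r (haI z hz)
  | sup F₁ F₂ _ _ ih₁ ih₂ =>
    obtain ⟨I₁, hI₁, hmul₁⟩ := ih₁ (le_sup_left.trans h)
    obtain ⟨I₂, hI₂, hmul₂⟩ := ih₂ (le_sup_right.trans h)
    refine ⟨I₁ * I₂, hI₁.mul hI₂, fun y hy z hz => ?_⟩
    obtain ⟨a, ha, b, hb, rfl⟩ := Submodule.mem_sup.mp hy
    rw [add_mul]
    exact add_mem (hmul₁ a ha z (Ideal.mul_le_left hz)) (hmul₂ b hb z (Ideal.mul_le_right hz))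

theorem mem_tilde_one_of_forall_mul_mem (s : SemistarOperation R K)
    (hint : ∀ x : K, IsIntegral R x → x ∈ s.tilde 1) {G : Submodule R K} (hG : G.FG)
    (hG0 : G ≠ ⊥) {w : K} (h : ∀ y ∈ G, w * y ∈ s.tilde G) : w ∈ s.tilde 1 := by
  have hle : G.map (LinearMap.mulLeft R w) ≤ s.tilde G := by
    rintro _ ⟨y, hy, rfl⟩
    exact h y hy
  obtain ⟨J, hJ, hwJ⟩ := s.exists_isDense_forall_mul_mem (hG.map _) hle
  rw [← s.tilde.idem']
  refine ⟨J, hJ, fun j hj => hint _ ?_⟩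
  refine isIntegral_of_smul_mem_submodule (M := K) G hG0 hG _ fun y hy => ?_
  rw [smul_eq_mul, mul_right_comm]
  exact hwJ _ ⟨y, hy, rfl⟩ j hj

theorem IsStarInvertible.eab_tilde_le {s : SemistarOperation R K}
    (hint : ∀ x : K, IsIntegral R x → x ∈ s.tilde 1) {E : Submodule R K}
    (hE : s.IsStarInvertible E) : s.tilde.eab E ≤ s.tilde E := by
  refine iSup_le fun F => iSup_le fun G x hx => ?_
  rw [Submodule.mem_div_iff_forall_mul_mem] at hx
  have hmul : ∀ b ∈ 1 / E, b * x ∈ s.tilde 1 := by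
    refine fun b hb => s.mem_tilde_one_of_forall_mul_mem hint G.2.1 G.2.2 fun y hy => ?_
    rw [mul_assoc]
    refine s.tilde.mul_mem_of_forall_mul_mem (fun z hz => s.tilde.le' _ ?_)
      (hx y (s.tilde.le' _ hy))
    have hle : 1 / E * (F.1 * G.1) ≤ G.1 := by
      rw [← mul_assoc, mul_comm (1 / E)]
      exact mul_le_of_le_one_left'
        ((mul_le_mul' F.2.2.2 le_rfl).trans Submodule.mul_one_div_le_one)
    exact hle (Submodule.mul_mem_mul hb hz)
  obtain ⟨J, hJ, hJE⟩ := hE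
  rw [← s.tilde.idem']
  refine ⟨J, hJ, fun j hj => ?_⟩
  have hle : E * (1 / E) ≤ (s.tilde E).comap (LinearMap.mulLeft R x) := by
    refine Submodule.mul_le.mpr fun e he b hb => ?_
    have hmem := s.tilde.mul_le E 1 (Submodule.mul_mem_mul he (hmul b hb))
    rwa [mul_one, mul_comm b, mul_left_comm] at hmem
  exact hle (hJE ⟨j, hj, rfl⟩)

theorem isIntegrallyClosed_tilde_ring [IsDomain R] [IsFractionRing R K]
    (s : SemistarOperation R K) (hint : ∀ x : K, IsIntegral R x → x ∈ s.tilde 1) :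
    IsIntegrallyClosed s.tilde.ring := by
  rw [isIntegrallyClosed_iff K]
  intro x hx
  obtain ⟨T, hT⟩ := hx.fg_adjoin_singleton
  let G := Submodule.span R (T : Set K)
  have hTG : ∀ y ∈ Algebra.adjoin s.tilde.ring {x}, y ∈ s.tilde G := by
    intro y hy
    rw [← Subalgebra.mem_toSubmodule, ← hT] at hy
    induction hy using Submodule.closure_induction with
    | zero => exact zero_mem _
    | add a b _ _ ha hb => exact add_mem ha hb
    | smul_mem a t ht =>
      have hmul := s.tilde.mul_le G 1 (Submodule.mul_mem_mul (Submodule.subset_span ht) a.2)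
      rwa [mul_one, mul_comm] at hmul
  have hGT : ∀ y ∈ G, y ∈ Algebra.adjoin s.tilde.ring {x} := by
    have hle : G ≤ (Algebra.adjoin s.tilde.ring {x}).toSubmodule.restrictScalars R :=
      Submodule.span_le.mpr fun t ht => hT.le (Submodule.subset_span ht)
    exact hle
  have hG0 : G ≠ ⊥ := by
    intro hbot
    have hone := hTG 1 (Subalgebra.one_mem _)
    rw [hbot, s.tilde.bot'] at hone
    exact one_ne_zero ((Submodule.mem_bot R).mp hone)
  have hxG : x ∈ s.tilde 1 := s.mem_tilde_one_of_forall_mul_mem hint ⟨T, rfl⟩ hG0 fun y hy =>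
    hTG _ (mul_mem (Algebra.self_mem_adjoin_singleton _ x) (hGT y hy))
  exact ⟨⟨x, hxG⟩, rfl⟩

end SemistarOperation

/-! ### Domination -/

namespace SemistarOperation

variable {R K : Type*} [CommRing R] [Field K] [Algebra R K]

theorem coeSubmodule_mul_le_of_le (s : SemistarOperation R K) {A B : Ideal R}
    (h : IsLocalization.coeSubmodule K A ≤ s (IsLocalization.coeSubmodule K B)) (L : Ideal R) :
    IsLocalization.coeSubmodule K (A * L) ≤ s (IsLocalization.coeSubmodule K (B * L)) := by
  rw [mul_comm A, mul_comm B, IsLocalization.coeSubmodule_mul, IsLocalization.coeSubmodule_mul]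
  exact (mul_le_mul_right h _).trans (s.mul_le _ _)

theorem IsDense.pow {s : SemistarOperation R K} {J : Ideal R} (hJ : s.IsDense J) (n : ℕ) :
    s.IsDense (J ^ n) := by
  induction n with
  | zero => simpa only [pow_zero, Ideal.one_eq_top] using s.isDense_top
  | succ n ih => exact pow_succ J n ▸ ih.mul hJ

end SemistarOperation

theorem le_radical_of_mul_le_mul {R : Type*} [CommRing R] [IsDomain R] {I J H : Ideal R}
    (hfg : H.FG) (h0 : H ≠ ⊥) (h : J * H ≤ I * H) : J ≤ I.radical := by
  intro j hj
  have : Module.Finite R H := Module.Finite.iff_fg.mpr hfg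
  obtain ⟨p, hp, -, hcoeff, haeval⟩ :=
    LinearMap.exists_monic_and_natDegree_eq_and_coeff_mem_pow_and_aeval_eq_zero R
      (algebraMap R (Module.End R H) j) I (by
        rintro _ ⟨x, rfl⟩
        rw [Submodule.mem_smul_top_iff]
        exact h (Ideal.mul_mem_mul hj x.2))
  obtain ⟨x, hx, hx0⟩ := Submodule.exists_mem_ne_zero_of_ne_bot h0
  have hpj : p.eval j = 0 := by
    rw [Polynomial.aeval_algebraMap_apply] at haeval
    have hpx := congrArg Subtype.val (LinearMap.congr_fun haeval ⟨x, hx⟩)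
    simpa [hx0] using hpx
  refine ⟨p.natDegree, ?_⟩
  rw [Polynomial.eval_eq_sum_range, Finset.sum_range_succ, hp.coeff_natDegree, one_mul] at hpj
  rw [eq_neg_of_add_eq_zero_right hpj]
  refine neg_mem (Ideal.sum_mem _ fun k hk => Ideal.mul_mem_right _ _ ?_)
  exact Ideal.pow_le_self (Nat.sub_ne_zero_of_lt (Finset.mem_range.mp hk)) (hcoeff k)

namespace GradedDomain

section Dominated

variable {Γ R K : Type*} [AddCancelCommMonoid Γ] [DecidableEq Γ] [CommRing R]
variable {𝒜 : Γ → AddSubgroup R} [GradedRing 𝒜] [Field K] [Algebra R K]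

variable (𝒜) in
/-- `I` is dominated by `J` if `I H ⊆ (J H)^⋆` for some nonzero finitely generated homogeneous
ideal `H`. For `I = C(f)` and `J = C(g)` this is the condition defining `f / g ∈ Kr(R, ⋆)`. -/
def Dominated (s : SemistarOperation R K) (I J : Ideal R) : Prop :=
  ∃ H : Ideal R, H.IsHomogeneous 𝒜 ∧ H.FG ∧ H ≠ ⊥ ∧
    IsLocalization.coeSubmodule K (I * H) ≤ s (IsLocalization.coeSubmodule K (J * H))

namespace Dominated

variable {s : SemistarOperation R K} {I J L M : Ideal R}

theorem of_coeSubmodule_le [Nontrivial R]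
    (h : IsLocalization.coeSubmodule K I ≤ s (IsLocalization.coeSubmodule K J)) :
    Dominated 𝒜 s I J :=
  ⟨⊤, Ideal.IsHomogeneous.top 𝒜, Ideal.fg_top R, top_ne_bot, by rwa [Ideal.mul_top, Ideal.mul_top]⟩

theorem of_le [Nontrivial R] (h : I ≤ J) : Dominated 𝒜 s I J :=
  of_coeSubmodule_le ((Submodule.map_mono h).trans (s.le' _))

theorem mul_right (h : Dominated 𝒜 s I J) (L : Ideal R) : Dominated 𝒜 s (I * L) (J * L) := by
  obtain ⟨H, hH, hfg, h0, hle⟩ := h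
  refine ⟨H, hH, hfg, h0, ?_⟩
  rw [mul_right_comm, mul_right_comm J]
  exact s.coeSubmodule_mul_le_of_le hle L

variable [IsDomain R]

theorem trans (h : Dominated 𝒜 s I J) (h' : Dominated 𝒜 s J L) : Dominated 𝒜 s I L := by
  obtain ⟨H, hH, hfg, h0, hle⟩ := h
  obtain ⟨H', hH', hfg', h0', hle'⟩ := h'
  refine ⟨H * H', hH.mul hH', hfg.mul hfg', mul_ne_zero h0 h0', ?_⟩
  have hIJ := s.coeSubmodule_mul_le_of_le hle H'
  have hJL := s.coeSubmodule_mul_le_of_le hle' H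
  rw [mul_right_comm, mul_right_comm L] at hJL
  rw [← mul_assoc, ← mul_assoc]
  exact hIJ.trans ((s.mono' _ _ hJL).trans (s.idem' _).le)

theorem mul (h : Dominated 𝒜 s I J) (h' : Dominated 𝒜 s L M) :
    Dominated 𝒜 s (I * L) (J * M) := by
  refine (h.mul_right L).trans ?_
  rw [mul_comm J L, mul_comm J M]
  exact h'.mul_right J

theorem sup (h : Dominated 𝒜 s I L) (h' : Dominated 𝒜 s J L) : Dominated 𝒜 s (I ⊔ J) L := by
  obtain ⟨H, hH, hfg, h0, hle⟩ := h
  obtain ⟨H', hH', hfg', h0', hle'⟩ := h'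
  refine ⟨H * H', hH.mul hH', hfg.mul hfg', mul_ne_zero h0 h0', ?_⟩
  rw [Ideal.sup_mul, IsLocalization.coeSubmodule_sup, ← mul_assoc, ← mul_assoc, ← mul_assoc]
  refine sup_le (s.coeSubmodule_mul_le_of_le hle H') ?_
  rw [mul_right_comm, mul_right_comm L]
  exact s.coeSubmodule_mul_le_of_le hle' H

theorem cancel_right (hL : L.IsHomogeneous 𝒜) (hfg : L.FG) (h0 : L ≠ ⊥)
    (h : Dominated 𝒜 s (I * L) (J * L)) : Dominated 𝒜 s I J := by
  obtain ⟨H, hH, hHfg, hH0, hle⟩ := h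
  refine ⟨L * H, hL.mul hH, hfg.mul hHfg, mul_ne_zero h0 hH0, ?_⟩
  rwa [← mul_assoc, ← mul_assoc]

end Dominated

variable (𝒜) in
theorem dominated_content_mul [IsDomain R] [IsAddTorsionFree Γ] (s : SemistarOperation R K)
    (f g : R) : Dominated 𝒜 s (content 𝒜 f * content 𝒜 g) (content 𝒜 (f * g)) := by
  rcases eq_or_ne f 0 with rfl | hf
  · exact .of_le (by rw [content_zero, Ideal.bot_mul]; exact bot_le)
  let n := numComponents 𝒜 g
  refine ⟨content 𝒜 f ^ n, content_pow_isHomogeneous 𝒜 f n, (content_fg 𝒜 f).pow,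
    pow_ne_zero n (content_ne_bot 𝒜 hf), (Submodule.map_mono ?_).trans (s.le' _)⟩
  rw [mul_right_comm, ← pow_succ', mul_comm (content 𝒜 (f * g))]
  exact content_pow_mul_content_le 𝒜 (Nat.le_succ n)

-- `f ^ 2 - (g v) ^ 2 ∈ W` factors as `(f + g v) (f - g v)`, and for a suitable unit `v` both
-- factors have content `C(f) + C(g)`.
theorem dominated_content_mul_content_of_sq_mem [IsDomain R] [IsAddTorsionFree Γ]
    (hunit : HasUnitOfNonzeroDegree 𝒜) (s : SemistarOperation R K) {W : Ideal R}
    (hW : W.IsHomogeneous 𝒜) {f g : R} (hf : f ^ 2 ∈ W) (hg : g ^ 2 ∈ W) :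
    Dominated 𝒜 s (content 𝒜 f * content 𝒜 g) W := by
  obtain ⟨v, hadd, hsub⟩ := exists_content_add_mul_eq_sup 𝒜 hunit f g
  have hmem : (f + g * v) * (f - g * v) ∈ W := by
    rw [← sq_sub_sq, mul_pow]
    exact sub_mem hf (Ideal.mul_mem_right _ _ hg)
  have hle : content 𝒜 f * content 𝒜 g ≤ content 𝒜 (f + g * v) * content 𝒜 (f - g * v) := by
    rw [hadd, hsub]
    exact Ideal.mul_mono le_sup_left le_sup_right
  exact (Dominated.of_le hle).trans ((dominated_content_mul 𝒜 s _ _).trans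
    (.of_le ((content_le_iff hW).mpr hmem)))

theorem Dominated.isDense [FaithfulSMul R K] [IsDomain R] {s : SemistarOperation R K}
    {J : Ideal R} (hfg : J.FG) (h : Dominated 𝒜 s.tilde ⊤ J) : s.IsDense J := by
  obtain ⟨H, -, hHfg, hH0, hle⟩ := h
  rw [Ideal.top_mul] at hle
  obtain ⟨D, hD, hDH⟩ := s.exists_isDense_forall_mul_mem (Submodule.FG.map _ hHfg) hle
  have hDJ : D * H ≤ J * H := by
    refine Ideal.mul_le.mpr fun d hd y hy => ?_
    obtain ⟨c, hc, hcdy⟩ := hDH _ ⟨y, hy, rfl⟩ d hd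
    rw [Algebra.linearMap_apply, Algebra.linearMap_apply, ← map_mul] at hcdy
    rwa [mul_comm d, ← FaithfulSMul.algebraMap_injective R K hcdy]
  obtain ⟨n, hn⟩ := Ideal.exists_pow_le_of_le_radical_of_fg
    (le_radical_of_mul_le_mul hHfg hH0 hDJ) hD.1
  have hJ := s.map_eq_map_one_of_isDense (hD.pow n) (SemistarOperation.coeSubmodule_le_one J)
    (Submodule.map_mono hn)
  exact ⟨hfg, s.ne_bot_of_eq_one hJ, hJ⟩

end Dominated

end GradedDomain

/-! ### The graded Nagata ring -/

namespace GradedDomain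

section Nagata

variable {Γ R K : Type*} [AddCancelCommMonoid Γ] [DecidableEq Γ] [CommRing R]
variable {𝒜 : Γ → AddSubgroup R} [GradedRing 𝒜] [Field K] [Algebra R K]

theorem mem_homogeneousQuotientField [IsDomain R] [IsFractionRing R K] {x : K} :
    x ∈ homogeneousQuotientField 𝒜 K ↔
      ∃ h ∈ homogeneousElements 𝒜, ∃ a : R, x * algebraMap R K h = algebraMap R K a := by
  change (∃ (a h : R) (_ : h ∈ homogeneousElements 𝒜),
    x = algebraMap R K a * (algebraMap R K h)⁻¹) ↔ _
  refine ⟨?_, ?_⟩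
  · rintro ⟨a, h, hh, rfl⟩
    exact ⟨h, hh, a, inv_mul_cancel_right₀ (by simpa using hh.2) _⟩
  · rintro ⟨h, hh, a, ha⟩
    exact ⟨a, h, hh, by rw [← ha, mul_inv_cancel_right₀ (by simpa using hh.2)]⟩

section

variable [IsAddTorsionFree Γ] {s : SemistarOperation R K}

theorem isDense_content {r : R} (hr : r ∈ nagataSet 𝒜 s) : s.IsDense (content 𝒜 r) :=
  ⟨content_fg 𝒜 r, s.ne_bot_of_eq_one hr, hr⟩

theorem exists_mem_nagataSet (hunit : HasUnitOfNonzeroDegree 𝒜) {J : Ideal R}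
    (hJ : s.IsDense J) : ∃ r ∈ J, r ∈ nagataSet 𝒜 s := by
  obtain ⟨r, hr, hle⟩ := exists_mem_le_content 𝒜 hunit hJ.1
  exact ⟨r, hr, s.map_eq_map_one_of_isDense hJ (SemistarOperation.coeSubmodule_le_one _)
    (Submodule.map_mono hle)⟩

theorem exists_content_mul_content_le {W : Ideal R} (hW : W.IsHomogeneous 𝒜) {g a : R}
    (hg : g ∈ nagataSet 𝒜 s) (h : g * a ∈ W) :
    ∃ z ∈ nagataSet 𝒜 s, content 𝒜 z * content 𝒜 a ≤ W := by
  obtain ⟨n, hn⟩ := exists_content_pow_mul_content_le hW h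
  have hpow : content 𝒜 (g ^ n) ≤ content 𝒜 g ^ n :=
    (content_le_iff (content_pow_isHomogeneous 𝒜 g n)).mpr
      (Ideal.pow_mem_pow (mem_content_self 𝒜 g) n)
  exact ⟨g ^ n, pow_mem hg n, (Ideal.mul_mono_left hpow).trans hn⟩

end

theorem isGradedPStarMD_iff [FaithfulSMul R K] {s : SemistarOperation R K} :
    IsGradedPStarMD 𝒜 s ↔ ∀ I : Ideal R, I.IsHomogeneous 𝒜 → I.FG → I ≠ ⊥ →
      s.IsStarInvertible (IsLocalization.coeSubmodule K I) :=
  forall₄_congr fun _ _ _ _ => (s.isStarInvertible_iff_finiteType_eq _).symm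

theorem coeSubmodule_colon_span_singleton [FaithfulSMul R K] {I : Ideal R} {a : R} (haI : a ∈ I)
    (ha : a ≠ 0) :
    IsLocalization.coeSubmodule K ((Ideal.span {a}).colon (I : Set R)) =
      IsLocalization.coeSubmodule K (Ideal.span {a}) * (1 / IsLocalization.coeSubmodule K I) := by
  have hinj := FaithfulSMul.algebraMap_injective R K
  have haK : algebraMap R K a ≠ 0 := (map_ne_zero_iff _ hinj).mpr ha
  rw [IsLocalization.coeSubmodule_span_singleton]
  ext x
  rw [Submodule.mem_span_singleton_mul]
  constructor
  · rintro ⟨d, hd, rfl⟩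
    refine ⟨algebraMap R K d / algebraMap R K a, ?_, mul_div_cancel₀ _ haK⟩
    rw [Submodule.mem_div_iff_forall_mul_mem]
    rintro _ ⟨v, hv, rfl⟩
    obtain ⟨c, hc⟩ := Ideal.mem_span_singleton'.mp (Submodule.mem_colon.mp hd v hv)
    refine Submodule.mem_one.mpr ⟨c, ?_⟩
    rw [Algebra.linearMap_apply, div_mul_eq_mul_div, eq_div_iff haK, ← map_mul, ← map_mul, hc,
      smul_eq_mul]
  · rintro ⟨w, hw, rfl⟩
    rw [Submodule.mem_div_iff_forall_mul_mem] at hw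
    obtain ⟨d, hd⟩ := Submodule.mem_one.mp (hw _ ⟨a, haI, rfl⟩)
    refine ⟨d, Submodule.mem_colon.mpr fun v hv => ?_, by
      rw [mul_comm]; exact hd⟩
    obtain ⟨c, hc⟩ := Submodule.mem_one.mp (hw _ ⟨v, hv, rfl⟩)
    refine Ideal.mem_span_singleton'.mpr ⟨c, hinj ?_⟩
    rw [Algebra.linearMap_apply] at hc hd
    rw [smul_eq_mul, map_mul, map_mul, hc, hd, mul_right_comm]

theorem mul_mem_mul_colon_iff [FaithfulSMul R K] {I : Ideal R} {a : R} (haI : a ∈ I)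
    (ha : a ≠ 0) {r : R} : r * a ∈ I * (Ideal.span {a}).colon (I : Set R) ↔
      algebraMap R K r ∈
        IsLocalization.coeSubmodule K I * (1 / IsLocalization.coeSubmodule K I) := by
  have hinj := FaithfulSMul.algebraMap_injective R K
  have haK : algebraMap R K a ≠ 0 := (map_ne_zero_iff _ hinj).mpr ha
  have hmem : algebraMap R K (r * a) ∈
      IsLocalization.coeSubmodule K (I * (Ideal.span {a}).colon (I : Set R)) ↔
        r * a ∈ I * (Ideal.span {a}).colon (I : Set R) := by
    rw [IsLocalization.mem_coeSubmodule]
    exact ⟨fun ⟨c, hc, hcr⟩ => hinj hcr ▸ hc, fun h => ⟨_, h, rfl⟩⟩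
  rw [← hmem, IsLocalization.coeSubmodule_mul, coeSubmodule_colon_span_singleton haI ha,
    mul_left_comm, IsLocalization.coeSubmodule_span_singleton, Submodule.mem_span_singleton_mul,
    mul_comm r, map_mul]
  exact ⟨fun ⟨w, hw, hwr⟩ => mul_left_cancel₀ haK hwr ▸ hw, fun h => ⟨_, h, rfl⟩⟩

variable [IsAddTorsionFree Γ] {s : SemistarOperation R K}

theorem isStarInvertible_of_mem_nagataSet [FaithfulSMul R K] {I : Ideal R}
    (hI : I.IsHomogeneous 𝒜) (h0 : I ≠ ⊥) {r : R} (hr : r ∈ nagataSet 𝒜 s)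
    (h : algebraMap R K r ∈
      IsLocalization.coeSubmodule K I * (1 / IsLocalization.coeSubmodule K I)) :
    s.IsStarInvertible (IsLocalization.coeSubmodule K I) := by
  obtain ⟨a, haI, hah, ha⟩ := exists_isHomogeneousElem_mem hI h0
  have hspan : (Ideal.span {a}).IsHomogeneous 𝒜 :=
    Ideal.homogeneous_span 𝒜 _ (by rintro _ rfl; exact hah)
  have hcontent : content 𝒜 r * Ideal.span {a} ≤ I * (Ideal.span {a}).colon (I : Set R) :=
    (content_mul_span_singleton_le 𝒜 hah r).trans
      ((content_le_iff (hI.mul (colon_isHomogeneous 𝒜 hspan hI))).mpr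
        ((mul_mem_mul_colon_iff haI ha).mpr h))
  refine ⟨content 𝒜 r, isDense_content hr, ?_⟩
  rintro _ ⟨c, hc, rfl⟩
  exact (mul_mem_mul_colon_iff haI ha).mp
    (hcontent (Ideal.mul_mem_mul hc (Ideal.mem_span_singleton_self a)))

variable [IsDomain R]

theorem exists_content_of_isStarInvertible [FaithfulSMul R K] (hunit : HasUnitOfNonzeroDegree 𝒜)
    {I : Ideal R} (hI : I.IsHomogeneous 𝒜) (h0 : I ≠ ⊥)
    (h : s.IsStarInvertible (IsLocalization.coeSubmodule K I)) :
    ∃ a ∈ homogeneousElements 𝒜, ∃ y : R, ∃ J : Ideal R, s.IsDense J ∧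
      I * content 𝒜 y ≤ Ideal.span {a} ∧ J * Ideal.span {a} ≤ I * content 𝒜 y := by
  obtain ⟨J, hJ, hJI⟩ := h
  obtain ⟨a, haI, hah, ha⟩ := exists_isHomogeneousElem_mem hI h0
  obtain ⟨r, hrJ, hr⟩ := exists_mem_nagataSet hunit hJ
  obtain ⟨T, T', hT, hT', hmem⟩ := Submodule.mem_span_mul_finite_of_mem_mul
    ((mul_mem_mul_colon_iff haI ha).mpr (hJI ⟨r, hrJ, rfl⟩))
  rw [← Submodule.span_mul_span] at hmem
  have hcol : ((Ideal.span {a}).colon (I : Set R)).IsHomogeneous 𝒜 :=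
    colon_isHomogeneous 𝒜 (Ideal.homogeneous_span 𝒜 _ (by rintro _ rfl; exact hah)) hI
  obtain ⟨y, hyT', hT'y⟩ := exists_mem_le_content 𝒜 hunit (J := Submodule.span R (T' : Set R))
    ⟨T', rfl⟩
  have hy : content 𝒜 y ≤ (Ideal.span {a}).colon (I : Set R) :=
    (content_le_iff hcol).mpr (Submodule.span_le.mpr hT' hyT')
  refine ⟨a, ⟨hah, ha⟩, y, content 𝒜 r, isDense_content hr, ?_, ?_⟩
  · rw [mul_comm]
    exact Ideal.mul_le.mpr fun b hb v hv => Submodule.mem_colon.mp (hy hb) v hv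
  · exact (content_mul_span_singleton_le 𝒜 hah r).trans
      ((content_le_iff (hI.mul (content_isHomogeneous 𝒜 y))).mpr
        (Ideal.mul_mono (Submodule.span_le.mpr hT) hT'y hmem))

variable [IsFractionRing R K]

theorem mem_nagataRing {x : K} : x ∈ nagataRing 𝒜 s ↔
    ∃ g ∈ nagataSet 𝒜 s, ∃ a : R, x * algebraMap R K g = algebraMap R K a := by
  change (∃ (a g : R) (_ : g ∈ nagataSet 𝒜 s),
    x = algebraMap R K a * (algebraMap R K g)⁻¹) ↔ _
  have h0 : ∀ g ∈ nagataSet 𝒜 s, algebraMap R K g ≠ 0 := fun g hg =>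
    IsFractionRing.to_map_ne_zero_of_mem_nonZeroDivisors (nagataSet_le 𝒜 s hg)
  refine ⟨?_, ?_⟩
  · rintro ⟨a, g, hg, rfl⟩
    exact ⟨g, hg, a, inv_mul_cancel_right₀ (h0 g hg) _⟩
  · rintro ⟨g, hg, a, h⟩
    exact ⟨a, g, hg, by rw [← h, mul_inv_cancel_right₀ (h0 g hg)]⟩

theorem mem_tilde_one_of_mem_nagataRing {x : K} (hx : x ∈ nagataRing 𝒜 s)
    (hxH : x ∈ homogeneousQuotientField 𝒜 K) : x ∈ s.tilde 1 := by
  obtain ⟨g, hg, b, hb⟩ := mem_nagataRing.mp hx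
  obtain ⟨h, ⟨hh, h0⟩, a, ha⟩ := mem_homogeneousQuotientField.mp hxH
  have hK : algebraMap R K h ≠ 0 := by simpa using h0
  have hdvd : g * a ∈ Ideal.span {h} := by
    refine Ideal.mem_span_singleton'.mpr ⟨b, FaithfulSMul.algebraMap_injective R K ?_⟩
    rw [map_mul, map_mul, ← ha, ← hb, mul_right_comm, mul_comm (algebraMap R K g)]
  obtain ⟨z, hz, hle⟩ := exists_content_mul_content_le
    (Ideal.homogeneous_span 𝒜 _ (by rintro _ rfl; exact hh)) hg hdvd
  refine ⟨content 𝒜 z, isDense_content hz, fun y hy => ?_⟩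
  obtain ⟨d, hd⟩ := Ideal.mem_span_singleton'.mp
    (hle (Ideal.mul_mem_mul hy (mem_content_self 𝒜 a)))
  refine Submodule.mem_one.mpr ⟨d, mul_right_cancel₀ hK ?_⟩
  rw [← map_mul, hd, map_mul, ← ha]
  ring

end Nagata

end GradedDomain

/-! ### Ideals of the graded Nagata ring -/

theorem exists_span_singleton_mul_le_of_map_le {R T : Type*} [CommRing R] [CommRing T]
    [Algebra R T] (S : Submonoid R) [IsLocalization S T] {I M : Ideal R} (hM : M.FG)
    (h : M.map (algebraMap R T) ≤ I.map (algebraMap R T)) :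
    ∃ m ∈ S, Ideal.span {m} * M ≤ I := by
  induction M, hM using Submodule.fg_induction with
  | singleton c =>
    obtain ⟨m, hm, hmc⟩ := (IsLocalization.algebraMap_mem_map_algebraMap_iff S T I c).mp
      (h (Ideal.mem_map_of_mem _ (Ideal.mem_span_singleton_self c)))
    refine ⟨m, hm, ?_⟩
    rwa [Ideal.submodule_span_eq, Ideal.span_singleton_mul_span_singleton,
      Ideal.span_singleton_le_iff_mem]
  | sup M₁ M₂ _ _ h₁ h₂ =>
    obtain ⟨m₁, hm₁, h₁⟩ := h₁ ((Ideal.map_mono le_sup_left).trans h)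
    obtain ⟨m₂, hm₂, h₂⟩ := h₂ ((Ideal.map_mono le_sup_right).trans h)
    refine ⟨m₁ * m₂, mul_mem hm₁ hm₂, ?_⟩
    rw [← Ideal.span_singleton_mul_span_singleton, Ideal.mul_sup]
    refine sup_le ?_ ?_
    · rw [mul_right_comm]
      exact Ideal.mul_le_left.trans h₁
    · rw [mul_assoc]
      exact Ideal.mul_le_right.trans h₂

theorem isPruferDomain_of_isBezout {D : Type*} [CommRing D] [IsDomain D] [IsBezout D] :
    IsPruferDomain D := by
  refine ⟨inferInstance, fun I hI h0 => ?_⟩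
  obtain ⟨⟨a, ha⟩⟩ := IsBezout.isPrincipal_of_FG I hI
  obtain rfl : I = Ideal.span {a} := ha
  have ha' : algebraMap D (FractionRing D) a ≠ 0 := by simpa using h0
  rw [FractionalIdeal.coeIdeal_span_singleton]
  exact IsUnit.of_mul_eq_one (FractionalIdeal.spanSingleton D⁰ (algebraMap D (FractionRing D) a)⁻¹)
    (by rw [FractionalIdeal.spanSingleton_mul_spanSingleton, mul_inv_cancel₀ ha',
      FractionalIdeal.spanSingleton_one])

theorem IsPruferDomain.exists_mul_eq_span_singleton {D : Type*} [CommRing D]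
    (hD : IsPruferDomain D) {A : Ideal D} (hA : A.FG) {a : D} (ha : a ∈ A) (ha0 : a ≠ 0) :
    ∃ B : Ideal D, A * B = Ideal.span {a} := by
  have := hD.1
  obtain ⟨u, hu⟩ := hD.2 A hA (by rintro rfl; exact ha0 (by simpa using ha))
  have hle : (Ideal.span {a} : FractionalIdeal D⁰ (FractionRing D)) ≤ u := by
    rw [hu, FractionalIdeal.coeIdeal_le_coeIdeal]
    exact (Ideal.span_singleton_le_iff_mem _).mpr ha
  obtain ⟨B, hB⟩ := FractionalIdeal.le_one_iff_exists_coeIdeal.mp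
    (show ((u⁻¹ : (FractionalIdeal D⁰ (FractionRing D))ˣ) : FractionalIdeal D⁰ (FractionRing D)) *
      (Ideal.span {a} : Ideal D) ≤ 1 by
      rw [← u.inv_mul]
      exact mul_le_mul_right hle _)
  refine ⟨B, FractionalIdeal.coeIdeal_injective (K := FractionRing D) ?_⟩
  change ((A * B : Ideal D) : FractionalIdeal D⁰ (FractionRing D)) = (Ideal.span {a} : Ideal D)
  rw [FractionalIdeal.coeIdeal_mul, hB, ← hu, Units.mul_inv_cancel_left]

namespace GradedDomain

section NagataIdeals

variable {Γ R K : Type*} [AddCancelCommMonoid Γ] [IsAddTorsionFree Γ] [DecidableEq Γ] [CommRing R]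
variable [IsDomain R] {𝒜 : Γ → AddSubgroup R} [GradedRing 𝒜] [Field K] [Algebra R K]
variable [IsFractionRing R K] {s : SemistarOperation R K}

instance isLocalization_nagataRing : IsLocalization (nagataSet 𝒜 s) (nagataRing 𝒜 s) :=
  Localization.subalgebra.isLocalization_ofField K _ (nagataSet_le 𝒜 s)

theorem map_content_eq_span_of_isGradedPStarMD (hunit : HasUnitOfNonzeroDegree 𝒜)
    (hmd : IsGradedPStarMD 𝒜 s) (f : R) :
    (content 𝒜 f).map (algebraMap R (nagataRing 𝒜 s)) =
      Ideal.span {algebraMap R (nagataRing 𝒜 s) f} := by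
  rcases eq_or_ne f 0 with rfl | hf
  · rw [content_zero, Ideal.map_bot, map_zero, Ideal.span_singleton_zero]
  refine le_antisymm ?_ ((Ideal.span_singleton_le_iff_mem _).mpr
    (Ideal.mem_map_of_mem _ (mem_content_self 𝒜 f)))
  have hC := content_isHomogeneous 𝒜 f
  have h0 := content_ne_bot 𝒜 hf
  obtain ⟨a, ⟨hah, ha⟩, y, J, hJ, hle, hge⟩ := exists_content_of_isStarInvertible hunit hC h0
    (isGradedPStarMD_iff.mp hmd _ hC (content_fg 𝒜 f) h0)
  obtain ⟨z, hz⟩ := Ideal.mem_span_singleton'.mp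
    (hle (Ideal.mul_mem_mul (mem_content_self 𝒜 f) (mem_content_self 𝒜 y)))
  have hspan : (Ideal.span {a}).IsHomogeneous 𝒜 :=
    Ideal.homogeneous_span 𝒜 _ (by rintro _ rfl; exact hah)
  have hJz : Dominated 𝒜 s.tilde J (content 𝒜 z) := by
    refine .cancel_right hspan (Submodule.fg_span_singleton a) (by simpa using ha)
      (.trans (.of_le hge) ((dominated_content_mul 𝒜 _ f y).trans (.of_le ?_)))
    rw [← hz, ← content_of_isHomogeneousElem hah]
    exact content_mul_le 𝒜 z a
  have htop : Dominated 𝒜 s.tilde ⊤ J := .of_coeSubmodule_le <| by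
    rw [hJ.tilde_eq, IsLocalization.coeSubmodule_top]
    exact s.tilde.le' 1
  have hzN : z ∈ nagataSet 𝒜 s := ((htop.trans hJz).isDense (content_fg 𝒜 z)).2.2
  refine Ideal.map_le_iff_le_comap.mpr fun c hc => ?_
  obtain ⟨d, hd⟩ := Ideal.mem_span_singleton'.mp
    (hle (Ideal.mul_mem_mul hc (mem_content_self 𝒜 y)))
  have hcz : c * z = d * f := mul_right_cancel₀ ha (by linear_combination c * hz - f * hd)
  have hu := IsLocalization.map_units (nagataRing 𝒜 s) ⟨z, hzN⟩
  rw [Ideal.mem_comap, ← Ideal.mul_unit_mem_iff_mem _ hu, ← map_mul, hcz, map_mul]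
  exact Ideal.mul_mem_left _ _ (Ideal.mem_span_singleton_self _)

theorem map_content_eq_span_of_isPrincipal
    (h : ∀ A : Ideal (nagataRing 𝒜 s), A.IsPrincipal → ∃ I : Ideal R,
      I.IsHomogeneous 𝒜 ∧ A = I.map (algebraMap R (nagataRing 𝒜 s))) (f : R) :
    (content 𝒜 f).map (algebraMap R (nagataRing 𝒜 s)) =
      Ideal.span {algebraMap R (nagataRing 𝒜 s) f} := by
  refine le_antisymm ?_ ((Ideal.span_singleton_le_iff_mem _).mpr
    (Ideal.mem_map_of_mem _ (mem_content_self 𝒜 f)))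
  obtain ⟨I, hI, hfI⟩ := h (Ideal.span {algebraMap R (nagataRing 𝒜 s) f}) ⟨⟨_, rfl⟩⟩
  have hmem : algebraMap R (nagataRing 𝒜 s) f ∈ I.map (algebraMap R (nagataRing 𝒜 s)) :=
    hfI ▸ Ideal.mem_span_singleton_self _
  rw [IsLocalization.algebraMap_mem_map_algebraMap_iff (nagataSet 𝒜 s)] at hmem
  obtain ⟨m, hm, hmf⟩ := hmem
  obtain ⟨z, hz, hle⟩ := exists_content_mul_content_le hI hm hmf
  rw [hfI, Ideal.map_le_iff_le_comap]
  intro c hc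
  rw [Ideal.mem_comap, IsLocalization.algebraMap_mem_map_algebraMap_iff (nagataSet 𝒜 s)]
  exact ⟨z, hz, hle (Ideal.mul_mem_mul (mem_content_self 𝒜 z) hc)⟩

theorem exists_isHomogeneous_map_eq
    (hG : ∀ f : R, (content 𝒜 f).map (algebraMap R (nagataRing 𝒜 s)) =
      Ideal.span {algebraMap R (nagataRing 𝒜 s) f}) (A : Ideal (nagataRing 𝒜 s)) :
    ∃ I : Ideal R, I.IsHomogeneous 𝒜 ∧ A = I.map (algebraMap R (nagataRing 𝒜 s)) := by
  have hle : A.under R ≤ ⨆ f : A.under R, content 𝒜 f.1 := fun f hf =>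
    Ideal.mem_iSup_of_mem (S := fun f : A.under R => content 𝒜 f.1) ⟨f, hf⟩
      (mem_content_self 𝒜 f)
  refine ⟨⨆ f : A.under R, content 𝒜 f.1,
    Ideal.IsHomogeneous.iSup fun f => content_isHomogeneous 𝒜 f.1, le_antisymm ?_ ?_⟩
  · exact (IsLocalization.map_under (nagataSet 𝒜 s) (nagataRing 𝒜 s) A).ge.trans
      (Ideal.map_mono hle)
  · rw [Ideal.map_iSup]
    refine iSup_le fun f => ?_
    rw [hG, Ideal.span_singleton_le_iff_mem]
    exact f.2

theorem exists_span_singleton_eq_span_algebraMap (x : nagataRing 𝒜 s) :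
    ∃ f : R, Ideal.span {x} = Ideal.span {algebraMap R (nagataRing 𝒜 s) f} := by
  obtain ⟨⟨f, z⟩, hfz⟩ := IsLocalization.surj (nagataSet 𝒜 s) x
  exact ⟨f, hfz ▸ (Ideal.span_singleton_mul_right_unit
    (IsLocalization.map_units (nagataRing 𝒜 s) z) x).symm⟩

theorem isBezout_nagataRing (hunit : HasUnitOfNonzeroDegree 𝒜)
    (hG : ∀ f : R, (content 𝒜 f).map (algebraMap R (nagataRing 𝒜 s)) =
      Ideal.span {algebraMap R (nagataRing 𝒜 s) f}) : IsBezout (nagataRing 𝒜 s) := by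
  rw [IsBezout.iff_span_pair_isPrincipal]
  intro x y
  obtain ⟨f, hf⟩ := exists_span_singleton_eq_span_algebraMap x
  obtain ⟨g, hg⟩ := exists_span_singleton_eq_span_algebraMap y
  obtain ⟨v, hv, -⟩ := exists_content_add_mul_eq_sup 𝒜 hunit f g
  refine ⟨⟨algebraMap R (nagataRing 𝒜 s) (f + g * v), ?_⟩⟩
  rw [Ideal.submodule_span_eq, Ideal.span_insert, ← hG, hv, Ideal.map_sup, hG, hG, ← hf, ← hg]

theorem isGradedPStarMD_of_isPruferDomain (hT : IsPruferDomain (nagataRing 𝒜 s)) :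
    IsGradedPStarMD 𝒜 s := by
  refine isGradedPStarMD_iff.mpr fun I hI hfg h0 => ?_
  obtain ⟨a, haI, ha⟩ := Submodule.exists_mem_ne_zero_of_ne_bot h0
  have hinj : Function.Injective (algebraMap R (nagataRing 𝒜 s)) :=
    IsLocalization.injective _ (nagataSet_le 𝒜 s)
  obtain ⟨B, hB⟩ := hT.exists_mul_eq_span_singleton (hfg.map (algebraMap R (nagataRing 𝒜 s)))
    (Ideal.mem_map_of_mem _ haI) ((map_ne_zero_iff _ hinj).mpr ha)
  rw [← IsLocalization.map_under (nagataSet 𝒜 s) (nagataRing 𝒜 s) B, ← Ideal.map_mul] at hB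
  obtain ⟨r, hr, hra⟩ :=
    (IsLocalization.algebraMap_mem_map_algebraMap_iff (nagataSet 𝒜 s) _ _ _).mp
      (hB.ge (Ideal.mem_span_singleton_self _))
  obtain ⟨T, T', hT, hT', hmem⟩ := Submodule.mem_span_mul_finite_of_mem_mul hra
  rw [← Submodule.span_mul_span] at hmem
  let L : Ideal R := Submodule.span R (T' : Set R)
  have hraL : r * a ∈ I * L := Ideal.mul_mono_left (Submodule.span_le.mpr hT) hmem
  obtain ⟨m, hm, hma⟩ := exists_span_singleton_mul_le_of_map_le (I := Ideal.span {a})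
    (T := nagataRing 𝒜 s) (nagataSet 𝒜 s) (hfg.mul (⟨T', rfl⟩ : L.FG)) <| by
      rw [Ideal.map_span, Set.image_singleton, ← hB]
      exact Ideal.map_mono (Ideal.mul_mono_right (Submodule.span_le.mpr hT'))
  have hcolon : Ideal.span {m} * L ≤ (Ideal.span {a}).colon (I : Set R) := fun b hb =>
    Submodule.mem_colon.mpr fun v hv => hma (by
      rw [mul_left_comm, mul_comm I]
      exact Ideal.mul_mem_mul hb hv)
  refine isStarInvertible_of_mem_nagataSet hI h0 (mul_mem hm hr)
    ((mul_mem_mul_colon_iff haI ha).mp (Ideal.mul_mono_right hcolon ?_))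
  rw [mul_left_comm, mul_assoc]
  exact Ideal.mul_mem_mul (Ideal.mem_span_singleton_self m) hraL

end NagataIdeals

end GradedDomain

/-! ### The graded Kronecker function ring -/

section Flat

variable {R B : Type*} [CommRing R] [CommRing B] [Algebra R B]

theorem map_colon_singleton_eq_top_of_flat [Module.Flat R B] {f g : R} {x : B}
    (h : algebraMap R B g * x = algebraMap R B f) :
    ((Ideal.span {g}).colon {f}).map (algebraMap R B) = ⊤ := by
  obtain ⟨k, a, y, h1, h2⟩ := Module.Flat.isTrivialRelation_of_sum_smul_eq_zero
    (R := R) (M := B) (f := ![g, -f]) (x := ![x, 1])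
    (by simp [Fin.sum_univ_two, Algebra.smul_def, h])
  have hone : (1 : B) = ∑ j, a 1 j • y j := h1 1
  rw [Ideal.eq_top_iff_one, hone]
  refine Ideal.sum_mem _ fun j _ => ?_
  rw [Algebra.smul_def]
  refine Ideal.mul_mem_right _ _ (Ideal.mem_map_of_mem _ ?_)
  have hj : g * a 0 j + -f * a 1 j = 0 := by simpa [Fin.sum_univ_two] using h2 j
  exact Submodule.mem_colon_singleton.mpr
    (Ideal.mem_span_singleton'.mpr ⟨a 0 j, by rw [smul_eq_mul]; linear_combination hj⟩)

theorem map_colon_eq_top_of_flat [Module.Flat R B] {M : Ideal R} {f : R} (hM : M.FG)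
    (h : M.map (algebraMap R B) ≤ Ideal.span {algebraMap R B f}) :
    ((Ideal.span {f}).colon (M : Set R)).map (algebraMap R B) = ⊤ := by
  induction M, hM using Submodule.fg_induction with
  | singleton c =>
    obtain ⟨x, hx⟩ := Ideal.mem_span_singleton'.mp
      (h (Ideal.mem_map_of_mem _ (Submodule.mem_span_singleton_self c)))
    rw [Submodule.colon_span]
    exact map_colon_singleton_eq_top_of_flat ((mul_comm _ x).trans hx)
  | sup M₁ M₂ _ _ h₁ h₂ =>
    rw [eq_top_iff, ← Ideal.top_mul ⊤]
    nth_rw 1 [← h₁ ((Ideal.map_mono le_sup_left).trans h),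
      ← h₂ ((Ideal.map_mono le_sup_right).trans h)]
    rw [← Ideal.map_mul]
    refine Ideal.map_mono fun d hd => Submodule.mem_colon.mpr fun v hv => ?_
    obtain ⟨v₁, hv₁, v₂, hv₂, rfl⟩ := Submodule.mem_sup.mp hv
    rw [smul_add]
    exact add_mem (Submodule.mem_colon.mp (Ideal.mul_le_left hd) v₁ hv₁)
      (Submodule.mem_colon.mp (Ideal.mul_le_right hd) v₂ hv₂)

theorem exists_fg_le_map_eq_top {Q : Ideal R} (h : Q.map (algebraMap R B) = ⊤) :
    ∃ D : Ideal R, D.FG ∧ D ≤ Q ∧ D.map (algebraMap R B) = ⊤ := by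
  classical
  rw [Ideal.eq_top_iff_one, Ideal.map] at h
  obtain ⟨T, hT, h1⟩ := Submodule.mem_span_finite_of_mem_span h
  obtain ⟨S, hS, hST⟩ := Finset.subset_set_image_iff.mp hT
  refine ⟨Ideal.span S, ⟨S, rfl⟩, Ideal.span_le.mpr hS, ?_⟩
  rw [Ideal.eq_top_iff_one, Ideal.map_span]
  rwa [← hST, Finset.coe_image] at h1

end Flat

namespace GradedDomain

section Kronecker

variable {Γ R K : Type*} [AddCancelCommMonoid Γ] [IsAddTorsionFree Γ] [DecidableEq Γ] [CommRing R]
variable {𝒜 : Γ → AddSubgroup R} [GradedRing 𝒜] [Field K] [Algebra R K]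
variable {s t : SemistarOperation R K}

theorem mem_kroneckerSet_iff (hunit : HasUnitOfNonzeroDegree 𝒜) {x : K} :
    x ∈ kroneckerSet 𝒜 t ↔ ∃ f g : R, g ≠ 0 ∧ x = algebraMap R K f / algebraMap R K g ∧
      Dominated 𝒜 t (content 𝒜 f) (content 𝒜 g) := by
  refine exists₂_congr fun f g => and_congr_right fun _ => and_congr_right fun _ => ⟨?_, ?_⟩
  · rintro ⟨h, h0, hle⟩
    exact ⟨content 𝒜 h, content_isHomogeneous 𝒜 h, content_fg 𝒜 h, content_ne_bot 𝒜 h0, hle⟩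
  · rintro ⟨H, hH, hfg, h0, hle⟩
    obtain ⟨h, rfl⟩ := exists_content_eq hunit hH hfg
    exact ⟨h, fun hh => h0 (by rw [hh, content_zero]), hle⟩

variable [IsDomain R] [IsFractionRing R K]

theorem div_mem_kroneckerSet_iff (hunit : HasUnitOfNonzeroDegree 𝒜) {f g : R}
    (hg : g ≠ 0) : algebraMap R K f / algebraMap R K g ∈ kroneckerSet 𝒜 t ↔
      Dominated 𝒜 t (content 𝒜 f) (content 𝒜 g) := by
  rw [mem_kroneckerSet_iff hunit]
  refine ⟨?_, fun h => ⟨f, g, hg, rfl, h⟩⟩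
  rintro ⟨f', g', hg', heq, hdom⟩
  have hK : ∀ g : R, g ≠ 0 → algebraMap R K g ≠ 0 := fun g hg => by simpa using hg
  rw [div_eq_div_iff (hK g hg) (hK g' hg'), ← map_mul, ← map_mul] at heq
  have hfg : f * g' = f' * g := FaithfulSMul.algebraMap_injective R K heq
  refine Dominated.cancel_right (content_isHomogeneous 𝒜 g') (content_fg 𝒜 g')
    (content_ne_bot 𝒜 hg') ((dominated_content_mul 𝒜 t f g').trans ?_)
  rw [hfg, mul_comm (content 𝒜 g)]
  exact .trans (.of_le (content_mul_le 𝒜 _ _)) (hdom.mul_right _)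

variable (𝒜 t) in
/-- The graded Kronecker function ring `Kr(R, ⋆)`, as a subalgebra of `K`. -/
def kroneckerRing (hunit : HasUnitOfNonzeroDegree 𝒜) : Subalgebra R K where
  carrier := kroneckerSet 𝒜 t
  mul_mem' := by
    rintro x y hx hy
    obtain ⟨f, g, hg, rfl, h⟩ := (mem_kroneckerSet_iff hunit).mp hx
    obtain ⟨f', g', hg', rfl, h'⟩ := (mem_kroneckerSet_iff hunit).mp hy
    rw [div_mul_div_comm, ← map_mul, ← map_mul,
      div_mem_kroneckerSet_iff hunit (mul_ne_zero hg hg')]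
    exact .trans (.of_le (content_mul_le 𝒜 _ _))
      ((h.mul h').trans (dominated_content_mul 𝒜 t g g'))
  add_mem' := by
    rintro x y hx hy
    obtain ⟨f, g, hg, rfl, h⟩ := (mem_kroneckerSet_iff hunit).mp hx
    obtain ⟨f', g', hg', rfl, h'⟩ := (mem_kroneckerSet_iff hunit).mp hy
    have hK : ∀ g : R, g ≠ 0 → algebraMap R K g ≠ 0 := fun g hg => by simpa using hg
    have hle : content 𝒜 (f * g' + g * f') ≤
        content 𝒜 f * content 𝒜 g' ⊔ content 𝒜 f' * content 𝒜 g :=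
      (content_add_le 𝒜 _ _).trans (sup_le_sup (content_mul_le 𝒜 _ _)
        (by rw [mul_comm g]; exact content_mul_le 𝒜 _ _))
    rw [div_add_div _ _ (hK g hg) (hK g' hg'), ← map_mul, ← map_mul, ← map_mul, ← map_add,
      div_mem_kroneckerSet_iff hunit (mul_ne_zero hg hg')]
    refine .trans (.of_le hle) (.trans (.sup (h.mul_right _) ?_) (dominated_content_mul 𝒜 t g g'))
    rw [mul_comm (content 𝒜 g)]
    exact h'.mul_right _
  algebraMap_mem' r := (mem_kroneckerSet_iff hunit).mpr ⟨r, 1, one_ne_zero, by simp,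
    .of_le (by rw [content_one]; exact le_top)⟩

theorem mem_span_of_div_mem_kroneckerRing {hunit : HasUnitOfNonzeroDegree 𝒜} {f g : R}
    (hg : g ≠ 0) (h : algebraMap R K f / algebraMap R K g ∈ kroneckerRing 𝒜 t hunit) :
    algebraMap R (kroneckerRing 𝒜 t hunit) f ∈
      Ideal.span {algebraMap R (kroneckerRing 𝒜 t hunit) g} :=
  Ideal.mem_span_singleton'.mpr
    ⟨⟨_, h⟩, Subtype.ext (div_mul_cancel₀ _ (by simpa using hg : algebraMap R K g ≠ 0))⟩

theorem map_content_kroneckerRing (hunit : HasUnitOfNonzeroDegree 𝒜) (f : R) :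
    (content 𝒜 f).map (algebraMap R (kroneckerRing 𝒜 t hunit)) =
      Ideal.span {algebraMap R (kroneckerRing 𝒜 t hunit) f} := by
  rcases eq_or_ne f 0 with rfl | hf
  · rw [content_zero, Ideal.map_bot, map_zero, Ideal.span_singleton_zero]
  refine le_antisymm (Ideal.map_le_iff_le_comap.mpr fun c hc => ?_)
    ((Ideal.span_singleton_le_iff_mem _).mpr (Ideal.mem_map_of_mem _ (mem_content_self 𝒜 f)))
  refine mem_span_of_div_mem_kroneckerRing hf ((div_mem_kroneckerSet_iff hunit hf).mpr ?_)
  exact .of_le ((content_le_iff (content_isHomogeneous 𝒜 f)).mpr hc)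

theorem nagataRing_le_kroneckerRing (hunit : HasUnitOfNonzeroDegree 𝒜) :
    nagataRing 𝒜 s ≤ kroneckerRing 𝒜 s.tilde hunit := by
  intro x hx
  obtain ⟨g, hg, a, h⟩ := mem_nagataRing.mp hx
  have hg0 : g ≠ 0 := nonZeroDivisors.ne_zero (nagataSet_le 𝒜 s hg)
  refine (mem_kroneckerSet_iff hunit).mpr
    ⟨a, g, hg0, eq_div_of_mul_eq (by simpa using hg0) h, .of_coeSubmodule_le ?_⟩
  rw [(isDense_content hg).tilde_eq]
  exact (SemistarOperation.coeSubmodule_le_one _).trans (s.tilde.le' 1)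

theorem mem_nagataSet_of_inv_mem_kroneckerRing {hunit : HasUnitOfNonzeroDegree 𝒜} {d : R}
    (hd : d ≠ 0) (h : (algebraMap R K d)⁻¹ ∈ kroneckerRing 𝒜 s.tilde hunit) :
    d ∈ nagataSet 𝒜 s := by
  have hdom : Dominated 𝒜 s.tilde (content 𝒜 1) (content 𝒜 d) :=
    (div_mem_kroneckerSet_iff hunit hd).mp (by rwa [map_one, one_div])
  rw [content_one] at hdom
  exact (hdom.isDense (content_fg 𝒜 d)).2.2

theorem kroneckerRing_le_nagataRing (hunit : HasUnitOfNonzeroDegree 𝒜)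
    (hG : ∀ f : R, (content 𝒜 f).map (algebraMap R (nagataRing 𝒜 s)) =
      Ideal.span {algebraMap R (nagataRing 𝒜 s) f}) :
    kroneckerRing 𝒜 s.tilde hunit ≤ nagataRing 𝒜 s := by
  rintro x ⟨f, g, hg, rfl, h, h0, hle⟩
  obtain ⟨J, hJ, hfhJ⟩ := hle ⟨f * h, Ideal.mul_mem_mul (mem_content_self 𝒜 f)
    (mem_content_self 𝒜 h), rfl⟩
  obtain ⟨z, hzJ, hz⟩ := exists_mem_nagataSet hunit hJ
  obtain ⟨c, hc, hcz⟩ := hfhJ z hzJ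
  obtain rfl : c = f * h * z := FaithfulSMul.algebraMap_injective R K
    (hcz.trans (map_mul (algebraMap R K) _ _).symm)
  have hmap := Ideal.mem_map_of_mem (algebraMap R (nagataRing 𝒜 s)) hc
  rw [Ideal.map_mul, hG, hG, Ideal.span_singleton_mul_span_singleton] at hmap
  obtain ⟨w, hw⟩ := Ideal.mem_span_singleton'.mp hmap
  have hwK : (w : K) * (algebraMap R K g * algebraMap R K h) =
      algebraMap R K f * algebraMap R K h * algebraMap R K z := by
    simpa [map_mul] using congrArg Subtype.val hw
  obtain ⟨g', hg', a, ha⟩ := mem_nagataRing.mp w.2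
  have hgK : algebraMap R K g ≠ 0 := by simpa using hg
  have hhK : algebraMap R K h ≠ 0 := by simpa using h0
  have hwz : algebraMap R K f / algebraMap R K g * algebraMap R K z = w := by
    rw [div_mul_eq_mul_div, div_eq_iff hgK]
    exact mul_right_cancel₀ hhK (by linear_combination -hwK)
  exact mem_nagataRing.mpr ⟨z * g', mul_mem hz hg', a, by rw [map_mul, ← mul_assoc, hwz, ha]⟩

theorem isGradedPStarMD_of_flat (hunit : HasUnitOfNonzeroDegree 𝒜)
    [Module.Flat R (kroneckerRing 𝒜 s.tilde hunit)] : IsGradedPStarMD 𝒜 s := by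
  refine isGradedPStarMD_iff.mpr fun I hI hfg h0 => ?_
  obtain ⟨f, rfl⟩ := exists_content_eq hunit hI hfg
  have hf : f ≠ 0 := by rintro rfl; exact h0 (content_zero 𝒜)
  obtain ⟨D, hD, hle, hDtop⟩ := exists_fg_le_map_eq_top
    (map_colon_eq_top_of_flat hfg (map_content_kroneckerRing (t := s.tilde) hunit f).le)
  obtain ⟨d, hd, hd'⟩ := exists_mem_le_content 𝒜 hunit hD
  have hspan : Ideal.span {algebraMap R (kroneckerRing 𝒜 s.tilde hunit) d} = ⊤ := by
    rw [eq_top_iff, ← hDtop, ← map_content_kroneckerRing]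
    exact Ideal.map_mono hd'
  obtain ⟨w, hw⟩ := Ideal.mem_span_singleton'.mp ((Ideal.eq_top_iff_one _).mp hspan)
  have hwK : (w : K) * algebraMap R K d = 1 := congrArg Subtype.val hw
  have hd0 : d ≠ 0 := by
    rintro rfl
    simp at hwK
  have hdN : d ∈ nagataSet 𝒜 s := mem_nagataSet_of_inv_mem_kroneckerRing (hunit := hunit) hd0 <| by
    rw [← eq_inv_of_mul_eq_one_left hwK]
    exact w.2
  refine isStarInvertible_of_mem_nagataSet hI h0 hdN
    ((mul_mem_mul_colon_iff (mem_content_self 𝒜 f) hf).mp ?_)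
  rw [mul_comm d]
  exact Ideal.mul_mem_mul (mem_content_self 𝒜 f) (hle hd)

end Kronecker

end GradedDomain

/-! ### Integral elements over a graded domain -/

theorem exists_addMonoidHom_rat_injOn {Γ : Type*} [AddCancelCommMonoid Γ] [IsAddTorsionFree Γ]
    {S : Set Γ} (hS : S.Finite) : ∃ φ : Γ →+ ℚ, Set.InjOn φ S := by
  let ι : Γ →+ DivisibleHull (Algebra.GrothendieckAddGroup Γ) :=
    (DivisibleHull.coeAddMonoidHom _).comp (AddLocalization.addMonoidOf ⊤).toAddMonoidHom
  have hι : Function.Injective ι := DivisibleHull.coe_injective.comp <| by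
    simpa using! AddLocalization.mk_left_injective 0
  have : Finite S := hS
  obtain ⟨l, hl⟩ := Module.exists_dual_forall_apply_ne_zero (K := ℚ)
    (fun p : {p : S × S // p.1 ≠ p.2} => ι p.1.1 - ι p.1.2)
    fun p => sub_ne_zero.mpr fun h => p.2 (Subtype.ext (hι h))
  refine ⟨l.toAddMonoidHom.comp ι, fun a ha b hb hab => ?_⟩
  by_contra hne
  exact hl ⟨(⟨a, ha⟩, ⟨b, hb⟩), fun h => hne (congrArg Subtype.val h)⟩
    (by rw [map_sub]; exact sub_eq_zero.mpr hab)

section AddMonoidAlgebra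

theorem isPrincipalIdealRing_of_isLocalization {A B : Type*} [CommRing A] [IsPrincipalIdealRing A]
    [CommRing B] [Algebra A B] (S : Submonoid A) [IsLocalization S B] :
    IsPrincipalIdealRing B := by
  refine ⟨fun I => ?_⟩
  rw [← IsLocalization.map_under S B I]
  infer_instance

theorem mem_range_mapDomainRingHom {K G G' : Type*} [Ring K] [AddMonoid G] [AddMonoid G']
    {φ : G →+ G'} (hφ : Function.Injective φ) {x : AddMonoidAlgebra K G'}
    (hx : (x.coeff.support : Set G') ⊆ Set.range φ) :
    x ∈ (AddMonoidAlgebra.mapDomainRingHom K φ).range :=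
  ⟨x.comapDomain φ hφ, AddMonoidAlgebra.mapDomain_comapDomain hx hφ⟩

-- Two elements of `K[ℚ]` lie in a copy `K[T^{1/b}, T^{-1/b}]` of the Laurent polynomials.
theorem isBezout_addMonoidAlgebra_rat (K : Type*) [Field K] :
    IsBezout (AddMonoidAlgebra K ℚ) := by
  classical
  have : IsPrincipalIdealRing (AddMonoidAlgebra K ℤ) :=
    isPrincipalIdealRing_of_isLocalization (B := LaurentPolynomial K)
      (Submonoid.powers (Polynomial.X : Polynomial K))
  refine IsBezout.iff_span_pair_isPrincipal.mpr fun f g => ?_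
  obtain ⟨b, hb⟩ := IsLocalization.exist_integer_multiples_of_finset ℤ⁰
    (f.coeff.support ∪ g.coeff.support)
  have hb0 : (b : ℚ) ≠ 0 := Int.cast_ne_zero.mpr (nonZeroDivisors.coe_ne_zero b)
  let φ : ℤ →+ ℚ := (AddMonoidHom.mulRight (b : ℚ)⁻¹).comp (Int.castAddHom ℚ)
  have hφ : Function.Injective φ :=
    (mul_left_injective₀ (inv_ne_zero hb0)).comp Int.cast_injective
  have hrange : ∀ r ∈ f.coeff.support ∪ g.coeff.support, r ∈ Set.range φ := by
    intro r hr
    obtain ⟨m, hm⟩ := hb r hr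
    refine ⟨m, (eq_mul_inv_iff_mul_eq₀ hb0).mpr ?_ |>.symm⟩
    rw [mul_comm, ← zsmul_eq_mul]
    exact hm.symm
  obtain ⟨f', rfl⟩ := mem_range_mapDomainRingHom hφ fun r hr =>
    hrange r (Finset.mem_union_left _ hr)
  obtain ⟨g', rfl⟩ := mem_range_mapDomainRingHom hφ fun r hr =>
    hrange r (Finset.mem_union_right _ hr)
  rw [← Set.image_pair, ← Ideal.map_span]
  infer_instance

theorem mem_range_mapRingHom_subtype {K G : Type*} [Ring K] [AddMonoid G] {A : Subring K}
    {x : AddMonoidAlgebra K G} :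
    x ∈ (AddMonoidAlgebra.mapRingHom G A.subtype).range ↔ ∀ i, x.coeff i ∈ A := by
  simpa using! Set.ext_iff.mp (AddMonoidAlgebra.range_map (M := G) A.subtype.toAddMonoidHom) x

theorem coeff_mem_of_coeff_mul_mem {K G : Type*} [Field K] [AddMonoid G] [UniqueSums G]
    {A : Subring K} {u q : AddMonoidAlgebra K G} (hu0 : u ≠ 0) (hu : ∀ i, u.coeff i ∈ A)
    (hu' : ∀ i, (u.coeff i)⁻¹ ∈ A) (h : ∀ i, (q * u).coeff i ∈ A) (i : G) : q.coeff i ∈ A := by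
  classical
  let q' : AddMonoidAlgebra K G := .ofCoeff (q.coeff.filter fun j => q.coeff j ∉ A)
  have hq' : ∀ j, q'.coeff j = if q.coeff j ∉ A then q.coeff j else 0 :=
    Finsupp.filter_apply _ _
  have hsub : ∀ j, (q - q').coeff j ∈ A := by
    intro j
    rw [AddMonoidAlgebra.coeff_sub, Finsupp.sub_apply, hq']
    by_cases hj : q.coeff j ∈ A <;> simp [hj]
  have hmul : ∀ j, (q' * u).coeff j ∈ A := by
    rw [← mem_range_mapRingHom_subtype] at h hu hsub ⊢
    rw [← sub_sub_cancel q q', sub_mul]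
    exact sub_mem h (mul_mem hsub hu)
  by_contra hi
  obtain ⟨k, hk, j, hj, huniq⟩ := UniqueSums.uniqueAdd_of_nonempty
    (A := q'.coeff.support) (B := u.coeff.support)
    ⟨i, by
      rw [Finsupp.mem_support_iff, hq', if_pos hi]
      exact fun h0 => hi (h0 ▸ zero_mem A)⟩
    (Finsupp.support_nonempty_iff.mpr (by simpa using hu0))
  have hkA : q'.coeff k ∈ A := by
    have := mul_mem (hmul (k + j)) (hu' j)
    rwa [AddMonoidAlgebra.coeff_mul_add_of_uniqueAdd huniq,
      mul_inv_cancel_right₀ (Finsupp.mem_support_iff.mp hj)] at this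
  have hqk : q.coeff k ∉ A := fun hc => Finsupp.mem_support_iff.mp hk (by simp [hq', hc])
  exact hqk (by rwa [hq', if_pos hqk] at hkA)

end AddMonoidAlgebra

namespace GradedDomain

variable {Γ R G : Type*} [AddCancelCommMonoid Γ] [DecidableEq Γ] [CommRing R] [AddMonoid G]
variable (𝒜 : Γ → AddSubgroup R) [GradedRing 𝒜] (K : Type*) [Field K] [Algebra R K]

/-- The homomorphism `∑ a_γ ↦ ∑ a_γ X^{φ γ}` from a graded ring to a monoid algebra, recording the
degrees of the components coarsened along `φ`. -/
noncomputable def regrade (φ : Γ →+ G) : R →+* AddMonoidAlgebra K G :=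
  (DirectSum.toSemiring (fun i => (AddMonoidAlgebra.singleAddHom (R := K) (φ i)).comp
    ((algebraMap R K).toAddMonoidHom.comp (𝒜 i).subtype))
    (by
      change AddMonoidAlgebra.single (φ 0) (algebraMap R K 1) = 1
      rw [map_one, map_zero]
      rfl)
    (by
      intro i j a b
      change AddMonoidAlgebra.single (φ (i + j)) (algebraMap R K (a * b)) =
        AddMonoidAlgebra.single (φ i) (algebraMap R K a) *
          AddMonoidAlgebra.single (φ j) (algebraMap R K b)
      rw [AddMonoidAlgebra.single_mul_single, map_mul, map_add])).comp
    (DirectSum.decomposeRingEquiv 𝒜).toRingHom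

variable {K} in
theorem regrade_of_mem (φ : Γ →+ G) {i : Γ} {a : R} (ha : a ∈ 𝒜 i) :
    regrade 𝒜 K φ a = AddMonoidAlgebra.single (φ i) (algebraMap R K a) := by
  have h : (DirectSum.decomposeRingEquiv 𝒜).toRingHom a = DirectSum.of _ i ⟨a, ha⟩ :=
    DirectSum.decompose_of_mem 𝒜 ha
  rw [regrade, RingHom.comp_apply, h, DirectSum.toSemiring_of]
  rfl

theorem coeff_regrade [∀ i (x : 𝒜 i), Decidable (x ≠ 0)] [DecidableEq G] (φ : Γ →+ G) (a : R)
    (j : G) : (regrade 𝒜 K φ a).coeff j = algebraMap R K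
      (∑ i ∈ (DirectSum.decompose 𝒜 a).support with φ i = j, DirectSum.decompose 𝒜 a i) := by
  conv_lhs => rw [← DirectSum.sum_support_decompose 𝒜 a]
  simp only [map_sum, regrade_of_mem 𝒜 φ (SetLike.coe_mem _), AddMonoidAlgebra.coeff_sum,
    Finsupp.finsetSum_apply, AddMonoidAlgebra.coeff_single, Finsupp.single_apply,
    Finset.sum_filter]
  refine Finset.sum_congr rfl fun i _ => ?_
  split_ifs <;> simp

theorem lift_one_regrade (φ : Γ →+ G) (a : R) :
    AddMonoidAlgebra.lift K K G 1 (regrade 𝒜 K φ a) = algebraMap R K a := by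
  induction a using DirectSum.Decomposition.inductionOn 𝒜 with
  | zero => simp
  | @homogeneous i m => simp [regrade_of_mem 𝒜 φ m.2, AddMonoidAlgebra.lift_single]
  | add a b ha hb => rw [map_add, map_add, map_add, ha, hb]

variable {K}

theorem regrade_injective [FaithfulSMul R K] (φ : Γ →+ G) :
    Function.Injective (regrade 𝒜 K φ) := fun a b h =>
  FaithfulSMul.algebraMap_injective R K <| by
    rw [← lift_one_regrade 𝒜 K φ a, h, lift_one_regrade]

variable [IsDomain R] [IsFractionRing R K]

theorem coeff_regrade_mem (φ : Γ →+ G) (a : R) (j : G) :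
    (regrade 𝒜 K φ a).coeff j ∈ homogeneousQuotientField 𝒜 K := by
  classical
  rw [coeff_regrade]
  exact Subalgebra.algebraMap_mem _ _

theorem inv_coeff_regrade_mem {φ : Γ →+ G} {a : R}
    (hφ : Set.InjOn φ {i | DirectSum.decompose 𝒜 a i ≠ 0}) (j : G) :
    ((regrade 𝒜 K φ a).coeff j)⁻¹ ∈ homogeneousQuotientField 𝒜 K := by
  classical
  rw [coeff_regrade]
  set S := (DirectSum.decompose 𝒜 a).support.filter fun i => φ i = j with hS
  rcases S.eq_empty_or_nonempty with h | ⟨i, hi⟩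
  · simp [h]
  have hSi : S = {i} := by
    refine Finset.eq_singleton_iff_unique_mem.mpr ⟨hi, fun k hk => ?_⟩
    rw [hS, Finset.mem_filter, DFinsupp.mem_support_toFun] at hi hk
    exact hφ hk.1 hi.1 (hk.2.trans hi.2.symm)
  have hi0 : (DirectSum.decompose 𝒜 a i : R) ≠ 0 := by
    simpa using (Finset.mem_filter.mp hi).1
  rw [hSi, Finset.sum_singleton, mem_homogeneousQuotientField]
  refine ⟨DirectSum.decompose 𝒜 a i, ⟨⟨i, SetLike.coe_mem _⟩, hi0⟩, 1, ?_⟩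
  rw [inv_mul_cancel₀ (by simpa using hi0), map_one]

-- Regrading by `ℚ` embeds `R` into `K[ℚ]`, which is integrally closed; as it is injective on the
-- degrees of `g`, the coefficients of the quotient `q` of `f` by `g` lie in `R_H`.
theorem mem_homogeneousQuotientField_of_isIntegral [IsAddTorsionFree Γ] {x : K}
    (hx : IsIntegral R x) : x ∈ homogeneousQuotientField 𝒜 K := by
  obtain ⟨f, g, hg, rfl⟩ := IsFractionRing.div_surjective R x
  have hg0 : g ≠ 0 := nonZeroDivisors.ne_zero hg
  have hgK : algebraMap R K g ≠ 0 := by simpa using hg0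
  obtain ⟨φ, hφ⟩ := exists_addMonoidHom_rat_injOn (finite_setOf_decompose_ne_zero 𝒜 g)
  have hψ := regrade_injective 𝒜 (K := K) φ
  have := isBezout_addMonoidAlgebra_rat K
  obtain ⟨q, hq⟩ : ∃ q, q * regrade 𝒜 K φ g = regrade 𝒜 K φ f := by
    let L := FractionRing (AddMonoidAlgebra K ℚ)
    have hinj : Function.Injective ((algebraMap (AddMonoidAlgebra K ℚ) L).comp (regrade 𝒜 K φ)) :=
      (FaithfulSMul.algebraMap_injective _ _).comp hψ
    let Ψ : K →+* L := IsFractionRing.lift hinj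
    have hΨ : ∀ a, Ψ (algebraMap R K a) = algebraMap _ L (regrade 𝒜 K φ a) :=
      IsFractionRing.lift_algebraMap hinj
    obtain ⟨q, hq⟩ := IsIntegrallyClosed.isIntegral_iff.mp
      (hx.map_of_comp_eq (regrade 𝒜 K φ) Ψ (RingHom.ext fun a => (hΨ a).symm))
    refine ⟨q, FaithfulSMul.algebraMap_injective (AddMonoidAlgebra K ℚ) L ?_⟩
    rw [map_mul, hq, ← hΨ, ← hΨ, ← map_mul, div_mul_cancel₀ _ hgK]
  have hqA : ∀ i, q.coeff i ∈ homogeneousQuotientField 𝒜 K :=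
    coeff_mem_of_coeff_mul_mem (A := (homogeneousQuotientField 𝒜 K).toSubring)
      (by simpa using hψ.ne hg0)
      (coeff_regrade_mem 𝒜 φ g) (inv_coeff_regrade_mem 𝒜 hφ)
      fun i => hq ▸ coeff_regrade_mem 𝒜 φ f i
  have hε := congrArg (AddMonoidAlgebra.lift K K ℚ 1) hq
  rw [map_mul, lift_one_regrade, lift_one_regrade] at hε
  rw [← hε, mul_div_cancel_right₀ _ hgK, AddMonoidAlgebra.lift_apply]
  exact sum_mem fun i _ => by simpa using hqA i

end GradedDomain

/-! ### The operation `⋆̃_a` and invertibility -/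

theorem isIntegral_of_add_mul_mem_range {R A : Type*} [CommRing R] [CommRing A] [Algebra R A]
    {x y : A} {b c : R} (hadd : x + y = algebraMap R A b) (hmul : x * y = algebraMap R A c) :
    IsIntegral R x := by
  refine ⟨Polynomial.X ^ 2 + (-Polynomial.C b * Polynomial.X + Polynomial.C c),
    Polynomial.monic_X_pow_add ?_, ?_⟩
  · refine lt_of_le_of_lt (b := 1) ?_ (by norm_num)
    compute_degree
  · simp only [Polynomial.eval₂_add, Polynomial.eval₂_pow, Polynomial.eval₂_X,
      Polynomial.eval₂_mul, Polynomial.eval₂_neg, Polynomial.eval₂_C, ← hadd, ← hmul]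
    ring

theorem coeSubmodule_ne_bot {R K : Type*} [CommRing R] [Field K] [Algebra R K]
    [IsFractionRing R K] {I : Ideal R} (hI : I ≠ ⊥) : IsLocalization.coeSubmodule K I ≠ ⊥ :=
  fun h => hI (IsFractionRing.coeSubmodule_injective R K
    (h.trans (IsLocalization.coeSubmodule_bot K).symm))

theorem mul_add_mul_mem_span_pair_mul_one_div {R K : Type*} [CommRing R] [Field K] [Algebra R K]
    {a b u v : K} (hua : u * a ∈ (1 : Submodule R K)) (hub : u * b ∈ (1 : Submodule R K))
    (hva : v * a ∈ (1 : Submodule R K)) (hvb : v * b ∈ (1 : Submodule R K)) :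
    u * a + v * b ∈ Submodule.span R {a, b} * (1 / Submodule.span R {a, b}) := by
  have hdiv {w : K} (hwa : w * a ∈ (1 : Submodule R K)) (hwb : w * b ∈ (1 : Submodule R K)) :
      w ∈ 1 / Submodule.span R {a, b} := by
    have hle : Submodule.span R {a, b} ≤ (1 : Submodule R K).comap (LinearMap.mulLeft R w) :=
      Submodule.span_le.mpr (Set.pair_subset hwa hwb)
    exact Submodule.mem_div_iff_forall_mul_mem.mpr fun y hy => hle hy
  rw [mul_comm u, mul_comm v]
  exact add_mem (Submodule.mul_mem_mul (Submodule.subset_span (by simp)) (hdiv hua hub))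
    (Submodule.mul_mem_mul (Submodule.subset_span (by simp)) (hdiv hva hvb))

theorem add_mul_mem_span_pair_mul_one_div {R K : Type*} [CommRing R] [Field K] [Algebra R K]
    {a b x y r : K} (ha : a ≠ 0) (hb : b ≠ 0) (hr : r ∈ (1 : Submodule R K))
    (hxr : x * r ∈ (1 : Submodule R K)) (hyr : y * r ∈ (1 : Submodule R K))
    (hx : x * b / a ∈ (1 : Submodule R K)) (hy : y * a / b ∈ (1 : Submodule R K)) :
    (x + y) * r ∈ Submodule.span R {a, b} * (1 / Submodule.span R {a, b}) := by
  have hxb : x * r / a * b ∈ (1 : Submodule R K) := by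
    rw [div_mul_eq_mul_div, mul_right_comm, mul_div_right_comm]
    exact one_mul (1 : Submodule R K) ▸ Submodule.mul_mem_mul hx hr
  have hya : y * r / b * a ∈ (1 : Submodule R K) := by
    rw [div_mul_eq_mul_div, mul_right_comm, mul_div_right_comm]
    exact one_mul (1 : Submodule R K) ▸ Submodule.mul_mem_mul hy hr
  rw [add_mul, ← div_mul_cancel₀ (x * r) ha, ← div_mul_cancel₀ (y * r) hb]
  exact mul_add_mul_mem_span_pair_mul_one_div (by rwa [div_mul_cancel₀ _ ha]) hxb hya
    (by rwa [div_mul_cancel₀ _ hb])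

namespace GradedDomain

section EAB

variable {Γ R K : Type*} [AddCancelCommMonoid Γ] [DecidableEq Γ]
variable [CommRing R] {𝒜 : Γ → AddSubgroup R} [GradedRing 𝒜]
variable [Field K] [Algebra R K] [IsFractionRing R K] {s : SemistarOperation R K}

theorem Dominated.coeSubmodule_le_eab {I J : Ideal R} (hfg : J.FG) (h0 : J ≠ ⊥)
    (h : Dominated 𝒜 s I J) :
    IsLocalization.coeSubmodule K I ≤ s.eab (IsLocalization.coeSubmodule K J) := by
  obtain ⟨H, -, hHfg, hH0, hle⟩ := h
  refine fun x hx => s.mem_eab_of_forall_mul_mem (Submodule.FG.map _ hfg)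
    (coeSubmodule_ne_bot h0) (G := IsLocalization.coeSubmodule K H) (Submodule.FG.map _ hHfg)
    (coeSubmodule_ne_bot hH0) fun y hy => ?_
  change _ ∈ s (IsLocalization.coeSubmodule K J * IsLocalization.coeSubmodule K H)
  rw [← IsLocalization.coeSubmodule_mul]
  exact hle (IsLocalization.coeSubmodule_mul K I H ▸ Submodule.mul_mem_mul hx hy)

variable [IsDomain R]

theorem exists_finset_subset_homogeneousElements_span_eq {I : Ideal R}
    (hI : I.IsHomogeneous 𝒜) (hfg : I.FG) :
    ∃ T : Finset R, (T : Set R) ⊆ homogeneousElements 𝒜 ∧ Ideal.span (T : Set R) = I := by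
  obtain ⟨S, rfl⟩ := (Ideal.IsHomogeneous.iff_exists 𝒜 I).mp hI
  rw [Ideal.span, ← Submodule.span_sdiff_singleton_zero] at hfg
  obtain ⟨T, hT, hTspan⟩ := (Submodule.fg_span_iff_fg_span_finset_subset _).mp hfg
  refine ⟨T, fun x hx => ?_, ?_⟩
  · obtain ⟨⟨y, -, rfl⟩, h0⟩ := hT hx
    exact ⟨y.2, h0⟩
  · rw [Ideal.span, Ideal.span, ← hTspan, Submodule.span_sdiff_singleton_zero]

variable [IsAddTorsionFree Γ]

theorem mem_tilde_one_of_isIntegral_of_isGradedPStarMD (hunit : HasUnitOfNonzeroDegree 𝒜)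
    (h : IsGradedPStarMD 𝒜 s) {x : K} (hx : IsIntegral R x) : x ∈ s.tilde 1 := by
  have : IsBezout (nagataRing 𝒜 s) :=
    isBezout_nagataRing hunit (map_content_eq_span_of_isGradedPStarMD hunit h)
  have : IsGCDMonoid (nagataRing 𝒜 s) := inferInstance
  obtain ⟨y, rfl⟩ := IsIntegrallyClosed.isIntegral_iff.mp (hx.tower_top (A := nagataRing 𝒜 s))
  exact mem_tilde_one_of_mem_nagataRing y.2 (mem_homogeneousQuotientField_of_isIntegral 𝒜 hx)

theorem tilde_eq_eab_of_isGradedPStarMD (hunit : HasUnitOfNonzeroDegree 𝒜)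
    (h : IsGradedPStarMD 𝒜 s) {I : Ideal R} (hI : I.IsHomogeneous 𝒜) (hfg : I.FG)
    (h0 : I ≠ ⊥) :
    s.tilde (IsLocalization.coeSubmodule K I) = s.tilde.eab (IsLocalization.coeSubmodule K I) :=
  le_antisymm (s.tilde.le_eab (Submodule.FG.map _ hfg) (coeSubmodule_ne_bot h0))
    ((isGradedPStarMD_iff.mp h I hI hfg h0).eab_tilde_le
      fun _ => mem_tilde_one_of_isIntegral_of_isGradedPStarMD hunit h)

section TildeEqEab

variable (heab : ∀ I : Ideal R, I.IsHomogeneous 𝒜 → I.FG → I ≠ ⊥ →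
  s.tilde (IsLocalization.coeSubmodule K I) = s.tilde.eab (IsLocalization.coeSubmodule K I))
include heab

theorem exists_mul_mem_span_sq (hunit : HasUnitOfNonzeroDegree 𝒜) {a b : R}
    (ha : SetLike.IsHomogeneousElem 𝒜 a) (ha0 : a ≠ 0) (hb : SetLike.IsHomogeneousElem 𝒜 b) :
    ∃ z ∈ nagataSet 𝒜 s, z * (a * b) ∈ Ideal.span {a ^ 2, b ^ 2} := by
  have hW : (Ideal.span {a ^ 2, b ^ 2}).IsHomogeneous 𝒜 := by
    refine Ideal.homogeneous_span 𝒜 _ ?_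
    rintro _ (rfl | rfl)
    exacts [pow_two a ▸ ha.mul ha, pow_two b ▸ hb.mul hb]
  have ha2 : a ^ 2 ∈ Ideal.span {a ^ 2, b ^ 2} := Ideal.subset_span (by simp)
  have hb2 : b ^ 2 ∈ Ideal.span {a ^ 2, b ^ 2} := Ideal.subset_span (by simp)
  have hfg : (Ideal.span {a ^ 2, b ^ 2}).FG := Submodule.fg_span (Set.toFinite _)
  have h0 : Ideal.span {a ^ 2, b ^ 2} ≠ ⊥ :=
    (Submodule.ne_bot_iff _).mpr ⟨_, ha2, pow_ne_zero 2 ha0⟩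
  have hab : algebraMap R K (a * b) ∈
      s.tilde (IsLocalization.coeSubmodule K (Ideal.span {a ^ 2, b ^ 2})) := by
    rw [heab _ hW hfg h0]
    exact (dominated_content_mul_content_of_sq_mem hunit s.tilde hW ha2 hb2).coeSubmodule_le_eab
      hfg h0 ⟨a * b, Ideal.mul_mem_mul (mem_content_self 𝒜 a) (mem_content_self 𝒜 b), rfl⟩
  obtain ⟨J, hJ, hmem⟩ := hab
  obtain ⟨z, hzJ, hz⟩ := exists_mem_nagataSet hunit hJ
  obtain ⟨c, hc, hcz⟩ := hmem z hzJ
  rw [Algebra.linearMap_apply, ← map_mul, mul_comm _ z] at hcz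
  exact ⟨z, hz, FaithfulSMul.algebraMap_injective R K hcz ▸ hc⟩

-- If `z a b = l a ^ 2 + m b ^ 2`, then `l a / b` and `m b / a` are the roots of
-- `X ^ 2 - z X + l m`.
theorem exists_isIntegral_add_eq (hunit : HasUnitOfNonzeroDegree 𝒜) {a b : R}
    (ha : a ∈ homogeneousElements 𝒜) (hb : b ∈ homogeneousElements 𝒜) :
    ∃ x y : K, IsIntegral R x ∧ IsIntegral R y ∧
      x * algebraMap R K b / algebraMap R K a ∈ (1 : Submodule R K) ∧
      y * algebraMap R K a / algebraMap R K b ∈ (1 : Submodule R K) ∧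
      ∃ z ∈ nagataSet 𝒜 s, x + y = algebraMap R K z := by
  have haK : algebraMap R K a ≠ 0 := by simpa using ha.2
  have hbK : algebraMap R K b ≠ 0 := by simpa using hb.2
  obtain ⟨z, hz, hmem⟩ := exists_mul_mem_span_sq heab hunit ha.1 ha.2 hb.1
  obtain ⟨l, m, hlm⟩ := Ideal.mem_span_pair.mp hmem
  have hadd : algebraMap R K (l * a) / algebraMap R K b +
      algebraMap R K (m * b) / algebraMap R K a = algebraMap R K z := by
    rw [div_add_div _ _ hbK haK, div_eq_iff (mul_ne_zero hbK haK)]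
    simp only [← map_mul, ← map_add]
    exact congrArg _ (by linear_combination hlm)
  have hmul : algebraMap R K (l * a) / algebraMap R K b *
      (algebraMap R K (m * b) / algebraMap R K a) = algebraMap R K (l * m) := by
    rw [div_mul_div_comm, div_eq_iff (mul_ne_zero hbK haK)]
    simp only [← map_mul]
    exact congrArg _ (by ring)
  refine ⟨_, _, isIntegral_of_add_mul_mem_range hadd hmul,
    isIntegral_of_add_mul_mem_range (add_comm _ _ |>.trans hadd) (mul_comm _ _ |>.trans hmul),
    ?_, ?_, z, hz, hadd⟩
  · rw [div_mul_cancel₀ _ hbK, map_mul, mul_div_cancel_right₀ _ haK]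
    exact Submodule.algebraMap_mem l
  · rw [div_mul_cancel₀ _ haK, map_mul, mul_div_cancel_right₀ _ hbK]
    exact Submodule.algebraMap_mem m

theorem isStarInvertible_span_pair (hunit : HasUnitOfNonzeroDegree 𝒜) {a b : R}
    (ha : a ∈ homogeneousElements 𝒜) (hb : b ∈ homogeneousElements 𝒜) :
    s.IsStarInvertible (Submodule.span R {algebraMap R K a, algebraMap R K b}) := by
  have haK : algebraMap R K a ≠ 0 := by simpa using ha.2
  have hbK : algebraMap R K b ≠ 0 := by simpa using hb.2
  obtain ⟨x, y, hx, hy, hxb, hya, z, hz, hxy⟩ := exists_isIntegral_add_eq heab hunit ha hb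
  have hone : s.tilde 1 = s.tilde.eab 1 := by
    simpa only [IsLocalization.coeSubmodule_top] using
      heab ⊤ (Ideal.IsHomogeneous.top 𝒜) (Ideal.fg_top R) top_ne_bot
  have hle : Submodule.span R {x, y} ≤ s.tilde 1 :=
    hone ▸ Submodule.span_le.mpr (Set.pair_subset (s.tilde.isIntegral_mem_eab_one hx)
      (s.tilde.isIntegral_mem_eab_one hy))
  obtain ⟨J, hJ, hJxy⟩ :=
    s.exists_isDense_forall_mul_mem (Submodule.fg_span (Set.toFinite _)) hle
  obtain ⟨r, hrJ, hr⟩ := exists_mem_nagataSet hunit hJ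
  have hmem := add_mul_mem_span_pair_mul_one_div haK hbK (Submodule.algebraMap_mem r)
    (hJxy x (Submodule.subset_span (by simp)) r hrJ)
    (hJxy y (Submodule.subset_span (by simp)) r hrJ) hxb hya
  rw [hxy, ← map_mul] at hmem
  have hspan : IsLocalization.coeSubmodule K (Ideal.span {a, b}) =
      Submodule.span R {algebraMap R K a, algebraMap R K b} := by
    rw [IsLocalization.coeSubmodule_span, Set.image_pair]
  rw [← hspan] at hmem ⊢
  refine isStarInvertible_of_mem_nagataSet (Ideal.homogeneous_span 𝒜 _ ?_)
    ((Submodule.ne_bot_iff _).mpr ⟨a, Ideal.subset_span (by simp), ha.2⟩) (mul_mem hz hr) hmem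
  rintro _ (rfl | rfl)
  exacts [ha.1, hb.1]

theorem isGradedPStarMD_of_tilde_eq_eab (hunit : HasUnitOfNonzeroDegree 𝒜) :
    IsGradedPStarMD 𝒜 s := by
  refine isGradedPStarMD_iff.mpr fun I hI hfg h0 => ?_
  obtain ⟨T, hT, rfl⟩ := exists_finset_subset_homogeneousElements_span_eq hI hfg
  obtain ⟨a, ha⟩ : T.Nonempty := by
    rw [Finset.nonempty_iff_ne_empty]
    rintro rfl
    exact h0 (by simp)
  have hinsert : insert (algebraMap R K a) (algebraMap R K '' T) = algebraMap R K '' T :=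
    Set.insert_eq_of_mem ⟨a, ha, rfl⟩
  rw [IsLocalization.coeSubmodule_span, ← hinsert]
  refine s.isStarInvertible_span_insert (T.finite_toSet.image _) ?_
  rw [hinsert]
  rintro _ ⟨b, hb, rfl⟩ _ ⟨c, hc, rfl⟩
  exact isStarInvertible_span_pair heab hunit (hT hb) (hT hc)

end TildeEqEab

end EAB

end GradedDomain

open GradedDomain in
theorem theorem4p6_general {Γ R K : Type*} [AddCancelCommMonoid Γ] [IsAddTorsionFree Γ]
    [DecidableEq Γ] [CommRing R] [IsDomain R] (𝒜 : Γ → AddSubgroup R) [GradedRing 𝒜]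
    [Field K] [Algebra R K] [IsFractionRing R K]
    (hunit : ∃ α : Γ, α ≠ 0 ∧ ∃ u ∈ 𝒜 α, IsUnit u)
    (s : SemistarOperation R K) :
    (∃ Kr : Subalgebra R K, (Kr : Set K) = GradedDomain.kroneckerSet 𝒜 s.tilde ∧
      List.TFAE [
        GradedDomain.IsGradedPStarMD 𝒜 s,
        ∀ A : Ideal (GradedDomain.nagataRing 𝒜 s), ∃ I : Ideal R, I.IsHomogeneous 𝒜 ∧
          A = I.map (algebraMap R (GradedDomain.nagataRing 𝒜 s)),
        ∀ A : Ideal (GradedDomain.nagataRing 𝒜 s), A.IsPrincipal → ∃ I : Ideal R,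
          I.IsHomogeneous 𝒜 ∧ A = I.map (algebraMap R (GradedDomain.nagataRing 𝒜 s)),
        IsPruferDomain (GradedDomain.nagataRing 𝒜 s),
        IsDomain (GradedDomain.nagataRing 𝒜 s) ∧ IsBezout (GradedDomain.nagataRing 𝒜 s),
        GradedDomain.nagataRing 𝒜 s = Kr,
        ∃ S : Submonoid R, IsLocalization S Kr,
        Module.Flat R Kr,
        ∀ I : Ideal R, I.IsHomogeneous 𝒜 → I.FG → I ≠ ⊥ →
          s.tilde (IsLocalization.coeSubmodule K I) =
            s.tilde.eab (IsLocalization.coeSubmodule K I)]) ∧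
    (GradedDomain.IsGradedPStarMD 𝒜 s → IsIntegrallyClosed s.tilde.ring) := by
  have hG (h : IsGradedPStarMD 𝒜 s) := map_content_eq_span_of_isGradedPStarMD hunit h
  refine ⟨⟨kroneckerRing 𝒜 s.tilde hunit, rfl, ?_⟩, fun h => s.isIntegrallyClosed_tilde_ring
    fun _ => mem_tilde_one_of_isIntegral_of_isGradedPStarMD hunit h⟩
  tfae_have 1 → 2 := fun h A => exists_isHomogeneous_map_eq (hG h) A
  tfae_have 2 → 3 := fun h A _ => h A
  tfae_have 3 → 5 := fun h =>
    ⟨inferInstance, isBezout_nagataRing hunit (map_content_eq_span_of_isPrincipal h)⟩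
  tfae_have 5 → 4 := fun ⟨_, _⟩ => isPruferDomain_of_isBezout
  tfae_have 4 → 1 := isGradedPStarMD_of_isPruferDomain
  tfae_have 1 → 6 := fun h => le_antisymm (nagataRing_le_kroneckerRing hunit)
    (kroneckerRing_le_nagataRing hunit (hG h))
  tfae_have 6 → 7 := fun h => h ▸ ⟨nagataSet 𝒜 s, inferInstance⟩
  tfae_have 7 → 8 := fun ⟨S, _⟩ => IsLocalization.flat _ S
  tfae_have 8 → 1 := fun h => isGradedPStarMD_of_flat hunit
  tfae_have 1 → 9 := fun h _ hI hfg h0 => tilde_eq_eab_of_isGradedPStarMD hunit h hI hfg h0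
  tfae_have 9 → 1 := fun h => isGradedPStarMD_of_tilde_eq_eab h hunit
  tfae_finish

theorem theorem4p6 {Γ R K : Type*} [AddCancelCommMonoid Γ] [IsAddTorsionFree Γ] [DecidableEq Γ]
    [CommRing R] [IsDomain R] (𝒜 : Γ → AddSubgroup R) [GradedRing 𝒜]
    [Field K] [Algebra R K] [IsFractionRing R K]
    (hunit : ∃ α : Γ, α ≠ 0 ∧ ∃ u ∈ 𝒜 α, IsUnit u)
    (s : SemistarOperation R K)
    (hs : s.ring < GradedDomain.homogeneousQuotientField 𝒜 K) :
    (∃ Kr : Subalgebra R K, (Kr : Set K) = GradedDomain.kroneckerSet 𝒜 s.tilde ∧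
      List.TFAE [
        GradedDomain.IsGradedPStarMD 𝒜 s,
        ∀ A : Ideal (GradedDomain.nagataRing 𝒜 s), ∃ I : Ideal R, I.IsHomogeneous 𝒜 ∧
          A = I.map (algebraMap R (GradedDomain.nagataRing 𝒜 s)),
        ∀ A : Ideal (GradedDomain.nagataRing 𝒜 s), A.IsPrincipal → ∃ I : Ideal R,
          I.IsHomogeneous 𝒜 ∧ A = I.map (algebraMap R (GradedDomain.nagataRing 𝒜 s)),
        IsPruferDomain (GradedDomain.nagataRing 𝒜 s),
        IsDomain (GradedDomain.nagataRing 𝒜 s) ∧ IsBezout (GradedDomain.nagataRing 𝒜 s),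
        GradedDomain.nagataRing 𝒜 s = Kr,
        ∃ S : Submonoid R, IsLocalization S Kr,
        Module.Flat R Kr,
        ∀ I : Ideal R, I.IsHomogeneous 𝒜 → I.FG → I ≠ ⊥ →
          s.tilde (IsLocalization.coeSubmodule K I) =
            s.tilde.eab (IsLocalization.coeSubmodule K I)]) ∧
    (GradedDomain.IsGradedPStarMD 𝒜 s → IsIntegrallyClosed s.tilde.ring) :=
  theorem4p6_general 𝒜 hunit s
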